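/- All rings are commutative of characteristic $0$. A difference ring $(A,\sigma)$ is a ring with a ring automorphism $\sigma$; $\mathrm{const}(A,\sigma)=\{c\in A\mid\sigma(c)=c\}$; a difference ring homomorphism is a ring homomorphism commuting with the automorphisms. For a field $K$ let $S(K)$ be the ring of sequences $K^{\mathbb N}$ modulo equality from some point on, with the shift automorphism $S$. If $K$ is a subfield of $A$ consisting of constants, a $K$-homomorphism (resp. $K$-embedding) $A\to S(K)$ is a (resp. injective) difference ring homomorphism $(A,\sigma)\to(S(K),S)$ with $c\mapsto(c,c,\dots)$ for $c\in K$. A $P$-extension of $(A,\sigma)$ is a Laurent polynomial ring $A\langle x_1\rangle\dots\langle x_r\rangle$ with an automorphism extending $\sigma$ and $\sigma(x_i)=\alpha_ix_i$; here always $\alpha_i\in A^*$. An $A$-extension of order $n>1$ is a ring $A[z]$ subject to $z^n=1$ (free over $A$ with basis $1,\dots,z^{n-1}$) with an automorphism extending $\sigma$, $\sigma(z)=\rho z$ and $\rho\in A^*$, $\rho^n=1$. They are called $\Pi$-extension and $R$-extension, respectively, if there are no new constants. A difference field $(F,\sigma)$ with $K=\mathrm{const}(F,\sigma)$ is radical-stable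 if for all $a\in F^*$, $m\ge1$ with $a^m\in\{\sigma(g)/g\mid g\in F^*\}$ there is $\rho\in K^*$ with $\rho^m=1$ and $a\rho\in\{\sigma(g)/g\mid g\in F^*\}$. For $\alpha_1,\dots,\alpha_r\in F^*$ let $M((\alpha_1,\dots,\alpha_r),F)=\{(n_1,\dots,n_r)\in\mathbb Z^r\mid\exists g\in F^*:\ \alpha_1^{n_1}\cdots\alpha_r^{n_r}=\sigma(g)/g\}$. **Theorem.** Let $(F,\sigma)$ be a radical-stable difference field with $K=\mathrm{const}(F,\sigma)$ and let $\bar\tau:F\to S(K)$ be a $K$-embedding. Let $(F\langle x_1\rangle\dots\langle x_r\rangle,\sigma)$ be a $P$-extension of $(F,\sigma)$ with $\alpha_i=\sigma(x_i)/x_i\in F^*$ and let $\tau:F\langle x_1\rangle\dots\langle x_r\rangle\to S(K)$ be a $K$-homomorphism with $\tau|_F=\bar\tau$. Suppose that $(d_1,0,\dots,0),(0,d_2,0,\dots,0),\dots,(0,\dots,0,d_u,0,\dots,0)$, with $1\le u\le r$ and non-negative integers $d_1\mid\dots\mid d_u$, is a $\mathbb Z$-basis of $M((\alpha_1,\dots,\alpha_r),F)$.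 Put $E=F\langle x_{u+1}\rangle\dots\langle x_r\rangle$. (1) $(E,\sigma)$ is a $\Pi$-extension of $(F,\sigma)$ and $\tau|_E$ is a $K$-embedding. (2a) If $d_u=1$, there are $\bar g_i\in F^*$ with $\sigma(\bar g_i)=\alpha_i\bar g_i$ and $c_i\in K^*$ $(1\le i\le u)$, and a surjective difference ring homomorphism $\lambda:F\langle x_1\rangle\dots\langle x_r\rangle\to E$ with $\lambda|_E=\mathrm{id}$ and $\lambda(x_i)=c_i\bar g_i$ for $1\le i\le u$, such that $\tau|_E(\lambda(f))=\tau(f)$ for all $f$. (2b) Otherwise $d_u>1$, and there are an $R$-extension $(E[z],\sigma)$ of $(E,\sigma)$ of order $d_u$ with $\rho=\sigma(z)/z\in K^*$, and a $K$-embedding $\tau':E[z]\to S(K)$ with $\tau'|_E=\tau|_E$ and $\tau'(z)=(\rho^k)_{k\ge0}$. Moreover there are $\bar g_i\in F^*$, $\nu_i\in\{0,\dots,d_u-1\}$ with $\sigma(\bar g_i)=\rho^{\nu_i}\alpha_i\bar g_i$, where $z^{\nu_i},z^{d_u-\nu_i},\rho^{\nu_i},\rho^{d_u-\nu_i}$ all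 have multiplicative order $d_i$, and $c_i\in K^*$ $(1\le i\le u)$, and a surjective difference ring homomorphism $\lambda:F\langle x_1\rangle\dots\langle x_r\rangle\to E[z]$ with $\lambda|_E=\mathrm{id}$ and $\lambda(x_i)=c_iz^{d_u-\nu_i}\bar g_i$ for $1\le i\le u$, such that $\tau'(\lambda(f))=\tau(f)$ for all $f$. (3) In both cases $\ker\tau=\ker\lambda=\langle x_1^{d_1}-(c_1\bar g_1)^{d_1},\dots,x_u^{d_u}-(c_u\bar g_u)^{d_u}\rangle$, an ideal of $F\langle x_1\rangle\dots\langle x_r\rangle$. (4) Suppose in addition that $(F,\sigma)$ is computable (elements of $F$ are coded by natural numbers such that $+$, $\cdot$, inversion and $\sigma$ are computable), that $\bar\tau(f)=(\mathrm{ev}(f,n))_{n\ge0}$ for a computable evaluation function $\mathrm{ev}:F\times\mathbb N\to K$ with a computable $o^\sigma$-function $L:F\to\mathbb N$ (i.e. $\mathrm{ev}(f+g,n)=\mathrm{ev}(f,n)+\mathrm{ev}(g,n)$ and $\mathrm{ev}(fg,n)=\mathrm{ev}(f,n)\mathrm{ev}(g,n)$ for $n\ge\max(L(f),L(g))$, and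 $\mathrm{ev}(\sigma^l(f),n)=\mathrm{ev}(f,n+l)$ for $l\in\mathbb Z$, $n\ge L(f)+\max(0,-l)$) and a computable $Z:F\to\mathbb N$ with $\mathrm{ev}(f,n)\ne0$ for $f\ne0$, $n\ge Z(f)$, and that one can solve first-order homogeneous equations in $(F,\sigma)$ (an algorithm finds, given $w\in F^*$, some $g\in F^*$ with $\sigma(g)=wg$ whenever one exists). Then there is one algorithm that, for every extension as above, computes from $\alpha_1,\dots,\alpha_r$, $d_1,\dots,d_u$ and any $\kappa_i\in K$, $l_i\in\mathbb N$ with $\tau(x_i)=\big(\kappa_i\prod_{l_i\le k<n}\mathrm{ev}(\alpha_i,k)\big)_{n\ge0}$ elements $\rho,\nu_i,\bar g_i,c_i$ (in case $d_u=1$: $\bar g_i,c_i$) as in (2a), (2b), (3); in particular it yields the generators of $\ker\lambda=\ker\tau$. Moreover $(E,\sigma)$, resp. $(E[z],\sigma)$, is a computable difference ring with decidable equality and $\lambda$ is computable, where ring elements are given as lists of terms. -/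

import Mathlib

open Filter

universe v w

/-! ### Difference rings, constants, sequences -/

/-- The constant field `const(F, σ) = {c ∈ F | σ c = c}` of a difference field `(F, σ)`. -/
def constField {F : Type*} [Field F] (σ : F ≃+* F) : Subfield F :=
  (σ : F →+* F).eqLocusField (RingHom.id F)

/-- The ring of sequences with entries in `K`: elements of `K^ℕ`, where two sequences are
identified if they agree from some point on. -/
abbrev SeqRing (K : Type*) [Field K] : Type _ := Germ (atTop : Filter ℕ) K

/-- The class of a sequence in the ring of sequences. -/
abbrev toSeq {K : Type*} [Field K] (f : ℕ → K) : SeqRing K := (f : Germ (atTop : Filter ℕ) K)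

theorem tendsto_pred_atTop : Tendsto (fun n : ℕ => n - 1) atTop atTop :=
  tendsto_sub_atTop_nat 1

/-- The shift automorphism `S (a₀, a₁, a₂, …) = (a₁, a₂, …)` of the ring of sequences. -/
def seqShift (K : Type*) [Field K] : SeqRing K ≃+* SeqRing K where
  toFun f := f.compTendsto (fun n : ℕ => n + 1) (tendsto_add_atTop_nat 1)
  invFun f := f.compTendsto (fun n : ℕ => n - 1) tendsto_pred_atTop
  left_inv f := by
    induction f using Germ.inductionOn with
    | _ f =>
      refine Germ.coe_eq.2 ?_
      filter_upwards [eventually_ge_atTop 1] with n hn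
      simp [Nat.sub_add_cancel hn]
  right_inv f := by
    induction f using Germ.inductionOn with
    | _ f =>
      refine Germ.coe_eq.2 (Eventually.of_forall fun n => ?_)
      simp
  map_mul' f g := by
    induction f, g using Germ.inductionOn₂ with
    | _ f g => rfl
  map_add' f g := by
    induction f, g using Germ.inductionOn₂ with
    | _ f g => rfl

theorem seqShift_toSeq {K : Type*} [Field K] (f : ℕ → K) :
    seqShift K (toSeq f) = toSeq (fun n => f (n + 1)) := rfl

/-- `f` is a difference ring homomorphism `(A, σA) → (B, σB)`. -/
def IsDiffHom {A B : Type*} [CommRing A] [CommRing B] (σA : A ≃+* A) (σB : B ≃+* B)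
    (f : A →+* B) : Prop :=
  ∀ a, f (σA a) = σB (f a)

/-- `K`-homomorphisms `τ : (A, σA) → (S(K), S)`: difference ring homomorphisms with
`τ c = (c, c, c, …)` for `c ∈ K`; the inclusion of `K` in `A` is the map `incl`. -/
structure IsKHom {K A : Type*} [Field K] [CommRing A] (σA : A ≃+* A) (incl : K →+* A)
    (τ : A →+* SeqRing K) : Prop where
  diffHom : IsDiffHom σA (seqShift K) τ
  const : ∀ c : K, τ (incl c) = toSeq fun _ => c

/-- `K`-embeddings are the injective `K`-homomorphisms. -/
structure IsKEmbedding {K A : Type*} [Field K] [CommRing A] (σA : A ≃+* A) (incl : K →+* A)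
    (τ : A →+* SeqRing K) : Prop extends IsKHom σA incl τ where
  injective : Function.Injective τ

/-- The constants of `(B, σB)` are those of `(A, σA)`. -/
def NoNewConstants {A B : Type*} [CommRing A] [CommRing B] [Algebra A B] (σA : A ≃+* A)
    (σB : B ≃+* B) : Prop :=
  ∀ b, σB b = b → ∃ a, σA a = a ∧ algebraMap A B a = b

/-! ### `P`-, `Π`-, `A`- and `R`-extensions -/

/-- The Laurent monomial `∏ xᵢ ^ mᵢ`. -/
def laurentMonomial {B : Type*} [CommRing B] {k : ℕ} (x : Fin k → Bˣ) (m : Fin k → ℤ) : B :=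
  ((∏ i, x i ^ m i : Bˣ) : B)

/-- `(B, σB)` is a `P`-extension of `(A, σA)` with `B = A⟨x₁⟩…⟨x_k⟩`, the ring of Laurent
polynomials in `x₁, …, x_k` (the Laurent monomials form an `A`-basis of `B`), and
`σB xᵢ = αᵢ xᵢ` with `αᵢ ∈ A^*`. -/
structure IsPExtension {A B : Type*} [CommRing A] [CommRing B] [Algebra A B] (σA : A ≃+* A)
    (σB : B ≃+* B) {k : ℕ} (x : Fin k → Bˣ) (α : Fin k → Aˣ) : Prop where
  extends_aut : ∀ a, σB (algebraMap A B a) = algebraMap A B (σA a)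
  linearIndependent : LinearIndependent A (laurentMonomial x)
  span_eq_top : Submodule.span A (Set.range (laurentMonomial x)) = ⊤
  shift_gen : ∀ i, σB (x i) = algebraMap A B (α i) * x i

/-- A `Π`-extension is a `P`-extension without new constants. -/
structure IsPiExtension {A B : Type*} [CommRing A] [CommRing B] [Algebra A B] (σA : A ≃+* A)
    (σB : B ≃+* B) {k : ℕ} (x : Fin k → Bˣ) (α : Fin k → Aˣ) : Prop
    extends IsPExtension σA σB x α where
  noNewConstants : NoNewConstants (B := B) σA σB

/-- `(B, σB)` is an `A`-extension of `(A, σA)` of order `n > 1` with `B = A[z]` subject to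
`z ^ n = 1` (so `1, z, …, z ^ (n - 1)` is an `A`-basis of `B`), and `σB z = ρ z` with `ρ ^ n = 1`. -/
structure IsAExtension {A B : Type*} [CommRing A] [CommRing B] [Algebra A B] (σA : A ≃+* A)
    (σB : B ≃+* B) (z : B) (n : ℕ) (ρ : A) : Prop where
  one_lt : 1 < n
  extends_aut : ∀ a, σB (algebraMap A B a) = algebraMap A B (σA a)
  pow_eq_one : z ^ n = 1
  linearIndependent : LinearIndependent A (fun i : Fin n => z ^ (i : ℕ))
  span_eq_top : Submodule.span A (Set.range fun i : Fin n => z ^ (i : ℕ)) = ⊤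
  root_pow : ρ ^ n = 1
  shift_gen : σB z = algebraMap A B ρ * z

/-- An `R`-extension is an `A`-extension without new constants. -/
structure IsRExtension {A B : Type*} [CommRing A] [CommRing B] [Algebra A B] (σA : A ≃+* A)
    (σB : B ≃+* B) (z : B) (n : ℕ) (ρ : A) : Prop extends IsAExtension σA σB z n ρ where
  noNewConstants : NoNewConstants (B := B) σA σB

/-! ### Radical stability and the module `M` -/

/-- The homogeneous group `H_(F,σ) = {σ(g)/g | g ∈ F^*}`, as a subset of `F`. -/
def homogeneousGroup {F : Type*} [Field F] (σ : F ≃+* F) : Set F :=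
  {a | ∃ g : F, g ≠ 0 ∧ a = σ g / g}

/-- `(F, σ)` is radical-stable. -/
def RadicalStable {F : Type*} [Field F] (σ : F ≃+* F) : Prop :=
  ∀ (a : F) (m : ℕ), a ≠ 0 → 0 < m → a ^ m ∈ homogeneousGroup σ →
    ∃ ρ ∈ constField σ, ρ ^ m = 1 ∧ a * ρ ∈ homogeneousGroup σ

/-- The `ℤ`-module `M((α₁, …, α_r), F) ⊆ ℤ^r` of all `n` with `∏ αᵢ ^ nᵢ = σ(g)/g` for some
`g ∈ F^*`. -/
def relModule {F : Type*} [Field F] (σ : F ≃+* F) {r : ℕ} (α : Fin r → Fˣ) :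
    Submodule ℤ (Fin r → ℤ) :=
  AddSubgroup.toIntSubmodule
    { carrier := {n | ∏ i, (α i : F) ^ n i ∈ homogeneousGroup σ}
      zero_mem' := ⟨1, one_ne_zero, by simp⟩
      add_mem' := by
        rintro a b ⟨g, hg, h⟩ ⟨g', hg', h'⟩
        refine ⟨g * g', mul_ne_zero hg hg', ?_⟩
        simp only [Pi.add_apply]
        rw [Finset.prod_congr rfl fun i _ => zpow_add₀ (α i).ne_zero (a i) (b i),
          Finset.prod_mul_distrib, h, h', map_mul, div_mul_div_comm]
      neg_mem' := by
        rintro a ⟨g, hg, h⟩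
        refine ⟨g⁻¹, inv_ne_zero hg, ?_⟩
        simp only [Pi.neg_apply, zpow_neg, Finset.prod_inv_distrib]
        rw [h, map_inv₀, inv_div, inv_div_inv] }

/-! ### The situation of the theorem

The generators are `x₁, …, x_r` with `r = u + s`: the first `u` of them are the
`x (Fin.castAdd s i)`, and the remaining ones, `x_{u+1}, …, x_r`, are the `x (Fin.natAdd u j)`. -/

section Situation

variable {F : Type*} [Field F] {H : Type*} [CommRing H] [Algebra F H] {u s : ℕ}

/-- The inclusion of `K = const(F, σ)` in an `F`-algebra. -/
def constIncl (σ : F ≃+* F) (A : Type*) [CommRing A] [Algebra F A] : constField σ →+* A :=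
  (algebraMap F A).comp (constField σ).subtype

/-- `(H, σH)` is a `P`-extension `F⟨x₁⟩…⟨x_r⟩` of `(F, σ)` with `αᵢ = σ(xᵢ)/xᵢ ∈ F^*`,
`τ : H → S(K)` is a `K`-homomorphism extending `τF`, and
`(d₁,0,…,0), (0,d₂,0,…,0), …, (0,…,0,d_u,0,…,0)` with `d₁ ∣ ⋯ ∣ d_u` is a basis of the
`ℤ`-module `M((α₁,…,α_r), F)`. -/
structure SpecialCase (σ : F ≃+* F) (τF : F →+* SeqRing (constField σ)) (σH : H ≃+* H)
    (x : Fin (u + s) → Hˣ) (α : Fin (u + s) → Fˣ) (τ : H →+* SeqRing (constField σ))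
    (d : Fin u → ℕ) : Prop where
  isPExtension : IsPExtension σ σH x α
  isKHom : IsKHom σH (constIncl σ H) τ
  restrict : ∀ a, τ (algebraMap F H a) = τF a
  dvd : ∀ i j, i ≤ j → d i ∣ d j
  basis_linearIndependent :
    LinearIndependent ℤ fun i : Fin u => (Pi.single (Fin.castAdd s i) (d i : ℤ) : Fin (u + s) → ℤ)
  basis_span :
    Submodule.span ℤ (Set.range fun i : Fin u =>
      (Pi.single (Fin.castAdd s i) (d i : ℤ) : Fin (u + s) → ℤ)) = relModule σ α

/-- `d_u`, the last entry of `(d₁, …, d_u)`. -/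
def lastEntry (hu : 0 < u) (d : Fin u → ℕ) : ℕ := d ⟨u - 1, Nat.sub_one_lt_of_lt hu⟩

variable (F) in
/-- The subring `F⟨x_{u+1}⟩…⟨x_r⟩` of `F⟨x₁⟩…⟨x_r⟩`. -/
def tailRing (x : Fin (u + s) → Hˣ) : Subalgebra F H :=
  Algebra.adjoin F (⋃ j : Fin s,
    {(x (Fin.natAdd u j) : H), (((x (Fin.natAdd u j))⁻¹ : Hˣ) : H)})

variable (F) in
/-- `x_{u+1}, …, x_r` as units of `F⟨x_{u+1}⟩…⟨x_r⟩`. -/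
def tailGen (x : Fin (u + s) → Hˣ) (j : Fin s) : (tailRing F x)ˣ where
  val := ⟨x (Fin.natAdd u j), Algebra.subset_adjoin (Set.mem_iUnion.2 ⟨j, by simp⟩)⟩
  inv := ⟨((x (Fin.natAdd u j))⁻¹ : Hˣ), Algebra.subset_adjoin (Set.mem_iUnion.2 ⟨j, by simp⟩)⟩
  val_inv := Subtype.ext (by simp)
  inv_val := Subtype.ext (by simp)

/-- The restriction of `τ` to `F⟨x_{u+1}⟩…⟨x_r⟩`. -/
def tailTau {S : Type*} [CommRing S] (x : Fin (u + s) → Hˣ) (τ : H →+* S) :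
    tailRing F x →+* S :=
  τ.comp (tailRing F x).val.toRingHom

/-- The ideal `⟨x₁^{d₁} - (c₁ḡ₁)^{d₁}, …, x_u^{d_u} - (c_uḡ_u)^{d_u}⟩` of `F⟨x₁⟩…⟨x_r⟩`. -/
def relIdeal {σ : F ≃+* F} (x : Fin (u + s) → Hˣ) (d : Fin u → ℕ) (g : Fin u → Fˣ)
    (c : Fin u → constField σ) : Ideal H :=
  Ideal.span (Set.range fun i : Fin u =>
    (x (Fin.castAdd s i) : H) ^ d i - algebraMap F H ((c i : F) * g i) ^ d i)

/-- Part (1): with `E = F⟨x_{u+1}⟩…⟨x_r⟩` and `σE` the restriction of `σH` to `E`, `(E, σE)` is a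
`Π`-extension of `(F, σ)` and `τ|_E` is a `K`-embedding. -/
structure TailStatement (σ : F ≃+* F) (σH : H ≃+* H) (x : Fin (u + s) → Hˣ)
    (α : Fin (u + s) → Fˣ) (τ : H →+* SeqRing (constField σ))
    (σE : tailRing F x ≃+* tailRing F x) : Prop where
  restrict_aut : ∀ e, (σE e : H) = σH e
  isPiExtension : IsPiExtension σ σE (tailGen F x) fun j => α (Fin.natAdd u j)
  isKEmbedding : IsKEmbedding σE (constIncl σ (tailRing F x)) (tailTau x τ)

/-- Parts (2a) and (3), the case `d_u = 1`, for given `ḡᵢ ∈ F^*`, `cᵢ ∈ K^*` and `lam = λ`. -/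
structure PiFactorization (σ : F ≃+* F) (σH : H ≃+* H) (x : Fin (u + s) → Hˣ)
    (α : Fin (u + s) → Fˣ) (τ : H →+* SeqRing (constField σ)) (d : Fin u → ℕ)
    (σE : tailRing F x ≃+* tailRing F x) (g : Fin u → Fˣ) (c : Fin u → constField σ)
    (lam : H →+* tailRing F x) : Prop where
  shift_g : ∀ i, σ (g i) = α (Fin.castAdd s i) * g i
  c_ne_zero : ∀ i, c i ≠ 0
  lam_diffHom : IsDiffHom σH σE lam
  lam_surjective : Function.Surjective lam
  lam_tail : ∀ e : tailRing F x, lam e = e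
  lam_gen : ∀ i, lam (x (Fin.castAdd s i)) = algebraMap F (tailRing F x) (c i * g i)
  tau_lam : ∀ f, tailTau x τ (lam f) = τ f
  ker_tau : RingHom.ker τ = RingHom.ker lam
  ker_lam : RingHom.ker lam = relIdeal x d g c

/-- Parts (2b) and (3), the case `n = d_u > 1`, for given `ρ ∈ K`, `νᵢ ∈ ℕ`, `ḡᵢ ∈ F^*`,
`cᵢ ∈ K^*`, a difference ring `(B, σB)` with `B = E[z]`, and maps `τ' : E[z] → S(K)`,
`lam = λ : F⟨x₁⟩…⟨x_r⟩ → E[z]`. -/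
structure RFactorization (σ : F ≃+* F) (σH : H ≃+* H) (x : Fin (u + s) → Hˣ)
    (α : Fin (u + s) → Fˣ) (τ : H →+* SeqRing (constField σ)) (d : Fin u → ℕ) (n : ℕ)
    (σE : tailRing F x ≃+* tailRing F x) (ρ : constField σ) (ν : Fin u → ℕ) (g : Fin u → Fˣ)
    (c : Fin u → constField σ) {B : Type*} [CommRing B] [Algebra (tailRing F x) B]
    (σB : B ≃+* B) (z : B) (τ' : B →+* SeqRing (constField σ)) (lam : H →+* B) : Prop where
  isRExtension : IsRExtension σE σB z n (constIncl σ (tailRing F x) ρ)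
  tau'_isKEmbedding :
    IsKEmbedding σB ((algebraMap (tailRing F x) B).comp (constIncl σ (tailRing F x))) τ'
  tau'_tail : ∀ e, τ' (algebraMap (tailRing F x) B e) = tailTau x τ e
  tau'_z : τ' z = toSeq fun k => ρ ^ k
  nu_lt : ∀ i, ν i < n
  shift_g : ∀ i, σ (g i) = (ρ : F) ^ ν i * α (Fin.castAdd s i) * g i
  order_z : ∀ i, orderOf (z ^ ν i) = d i ∧ orderOf (z ^ (n - ν i)) = d i
  order_rho : ∀ i, orderOf (ρ ^ ν i) = d i ∧ orderOf (ρ ^ (n - ν i)) = d i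
  c_ne_zero : ∀ i, c i ≠ 0
  lam_diffHom : IsDiffHom σH σB lam
  lam_surjective : Function.Surjective lam
  lam_tail : ∀ e : tailRing F x, lam e = algebraMap (tailRing F x) B e
  lam_gen : ∀ i, lam (x (Fin.castAdd s i)) =
    algebraMap (tailRing F x) B (algebraMap F (tailRing F x) (c i)) * z ^ (n - ν i) *
      algebraMap (tailRing F x) B (algebraMap F (tailRing F x) (g i))
  tau_lam : ∀ f, τ' (lam f) = τ f
  ker_tau : RingHom.ker τ = RingHom.ker lam
  ker_lam : RingHom.ker lam = relIdeal x d g c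

end Situation

/-! ### Algorithmic notions

Elements of a computable field are given by a coding (`Primcodable`; in particular equality is
decidable); elements of the extensions are given by lists of terms. -/

section Algorithmic

variable {F : Type*} [Field F]

/-- `(F, σ)` is computable. -/
structure IsComputableDiffField [Primcodable F] (σ : F ≃+* F) : Prop where
  add : Computable₂ fun a b : F => a + b
  mul : Computable₂ fun a b : F => a * b
  inv : Computable fun a : F => a⁻¹
  aut : Computable fun a : F => σ a

/-- `ev` is an evaluation function for the difference field `(F, σ)`. -/
structure IsEvaluation (σ : F ≃+* F) (ev : F → ℕ → constField σ) : Prop where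
  const : ∀ c : constField σ, ∀ᶠ n in atTop, ev c n = c
  add : ∀ f g, ∀ᶠ n in atTop, ev (f + g) n = ev f n + ev g n
  mul : ∀ f g, ∀ᶠ n in atTop, ev (f * g) n = ev f n * ev g n
  shift : ∀ (f : F) (l : ℤ), ∀ᶠ n : ℕ in atTop,
    ev ((σ ^ l : RingAut F) f) n = ev f ((n : ℤ) + l).toNat

/-- `L` is an `o^σ`-function for `ev`. Under the bound in `shift` one has `n + l ≥ 0`. -/
structure IsOSigmaFunction (σ : F ≃+* F) (ev : F → ℕ → constField σ) (L : F → ℕ) : Prop where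
  add : ∀ f g n, max (L f) (L g) ≤ n → ev (f + g) n = ev f n + ev g n
  mul : ∀ f g n, max (L f) (L g) ≤ n → ev (f * g) n = ev f n * ev g n
  shift : ∀ (f : F) (l : ℤ) (n : ℕ), (L f : ℤ) + max 0 (-l) ≤ n →
    ev ((σ ^ l : RingAut F) f) n = ev f ((n : ℤ) + l).toNat

/-- `Z` is a `z`-function for `ev`. -/
def IsZFunction (σ : F ≃+* F) (ev : F → ℕ → constField σ) (Z : F → ℕ) : Prop :=
  ∀ f, f ≠ 0 → ∀ n, Z f ≤ n → ev f n ≠ 0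

/-- `τF` is `o^σ`-computable by means of the computable evaluation function `ev` with the
computable `o^σ`-function `L`, and `Z` is a computable `z`-function. -/
structure IsOSigmaComputable [Primcodable F] (σ : F ≃+* F) (τF : F →+* SeqRing (constField σ))
    (ev : F → ℕ → constField σ) (L Z : F → ℕ) : Prop where
  isEvaluation : IsEvaluation σ ev
  isOSigmaFunction : IsOSigmaFunction σ ev L
  isZFunction : IsZFunction σ ev Z
  computable_ev : Computable₂ fun (f : F) (n : ℕ) => (ev f n : F)
  computable_L : Computable L
  computable_Z : Computable Z
  tau_eq : ∀ f, τF f = toSeq (ev f)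

/-- One can solve first-order homogeneous difference equations in `(F, σ)`: some algorithm finds,
for `w ∈ F^*`, a `g ∈ F^*` with `σ g = w g` whenever there is one. -/
def CanSolveHomogeneous [Primcodable F] (σ : F ≃+* F) : Prop :=
  ∃ solve : F →. F, Partrec solve ∧
    ∀ w : F, w ≠ 0 → (∃ g : F, g ≠ 0 ∧ σ g = w * g) → ∃ g ∈ solve w, g ≠ 0 ∧ σ g = w * g

/-- `φ` is computable when the elements of `A`, `B` are given by codes via `repA`, `repB`. -/
def ComputableVia {C D A B : Type*} [Primcodable C] [Primcodable D] (repA : C → A) (repB : D → B)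
    (φ : A → B) : Prop :=
  ∃ f : C → D, Computable f ∧ ∀ a, φ (repA a) = repB (f a)

/-- `(A, σA)` is a computable difference ring via the representation `rep` of its elements. -/
structure IsComputableDiffRing {C A : Type*} [Primcodable C] [CommRing A] (rep : C → A)
    (σA : A ≃+* A) : Prop where
  surjective : Function.Surjective rep
  eq : ComputablePred fun p : C × C => rep p.1 = rep p.2
  add : ∃ f : C → C → C, Computable₂ f ∧ ∀ a b, rep (f a b) = rep a + rep b
  mul : ∃ f : C → C → C, Computable₂ f ∧ ∀ a b, rep (f a b) = rep a * rep b
  aut : ComputableVia rep rep σA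

/-- The element `∑ a x₁^{m₁}⋯x_k^{m_k}` given by a list of terms `(a, m)`. -/
def laurentRep {A : Type*} [CommRing A] [Algebra F A] {k : ℕ} (x : Fin k → Aˣ)
    (t : List (F × (Fin k → ℤ))) : A :=
  (t.map fun p => algebraMap F A p.1 * laurentMonomial x p.2).sum

/-- The element `∑ a x₁^{m₁}⋯x_k^{m_k} z^e` of `E[z]` given by a list of terms `(a, m, e)`. -/
def laurentRootRep {E B : Type*} [CommRing E] [Algebra F E] [CommRing B] [Algebra E B] {k : ℕ}
    (x : Fin k → Eˣ) (z : B) (t : List (F × (Fin k → ℤ) × ℕ)) : B :=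
  (t.map fun p => algebraMap E B (algebraMap F E p.1 * laurentMonomial x p.2.1) * z ^ p.2.2).sum

end Algorithmic

/-!
A Laurent monomial `∏ xᵢ ^ mᵢ` is an eigenvector of the shift, up to a factor in `F`, and `τ` sends
two of them to `F`-dependent sequences exactly if their exponents differ by an element of `M`: a
shortest relation between inequivalent ones could be shortened further by means of the shift. This
gives (1), since `M` meets the exponents of `x_{u+1}, …, x_r` only in `0`. For `i ≤ u`, radical
stability splits the solution of `σ(g) / g = αᵢ ^ dᵢ` provided by `M` into a root of unity and some
`gᵢ` with `σ(gᵢ) = ρ^{νᵢ} αᵢ gᵢ`, where `ρ` is a primitive `d_u`-th root of unity, so that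
`τ xᵢ = (cᵢ ev(gᵢ, k) ρ^{-νᵢ k})ₖ` for a constant `cᵢ`. Modulo the relations
`xᵢ ^ dᵢ = (cᵢ gᵢ) ^ dᵢ` every exponent can be reduced modulo `dᵢ`, and then distinct monomials are
inequivalent; hence these relations generate `ker τ`, and `E[z]` is the quotient by this ideal.

The algorithm is an unbounded search for `(ρ, νᵢ, gᵢ, cᵢ)` together with a number `N`. That a
candidate is correct can be decided, because both sides of the identity of sequences above satisfy
the same first-order recurrence from a computable point on, so one comparison at a large `N` is
enough.
-/

/-! ### Computable functions on lists, predicates and integers -/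

section Computability

variable {α β γ : Type*} [Primcodable α] [Primcodable β] [Primcodable γ]

theorem computable_list_foldl {f : α → List β} {g : α → γ} {h : α → γ × β → γ}
    (hf : Computable f) (hg : Computable g) (hh : Computable₂ h) :
    Computable fun a => (f a).foldl (fun s b => h a (s, b)) (g a) := by
  have step : Computable₂ fun (a : α) (p : ℕ × γ) =>
      Option.casesOn (motive := fun _ => γ) ((f a)[p.1]?) p.2 (fun b => h a (p.2, b)) :=
    Computable.option_casesOn
      (Computable.list_getElem?.comp (hf.comp .fst) (Computable.fst.comp .snd))
      (Computable.snd.comp .snd)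
      (hh.comp (Computable.fst.comp .fst)
        ((Computable.snd.comp (Computable.snd.comp .fst)).pair .snd)).to₂
  refine (Computable.nat_rec (Computable.list_length.comp hf) hg step).of_eq fun a => ?_
  have foldl_take : ∀ k, k ≤ (f a).length →
      Nat.rec (motive := fun _ => γ) (g a) (fun y s =>
        Option.casesOn (motive := fun _ => γ) ((f a)[y]?) s (fun b => h a (s, b))) k =
      ((f a).take k).foldl (fun s b => h a (s, b)) (g a) := by
    intro k
    induction k with
    | zero => simp
    | succ k ih =>
      intro hk
      have hk' : k < (f a).length := hk
      simp only [List.take_add_one, List.foldl_append, ih hk'.le, List.getElem?_eq_getElem hk',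
        Option.toList_some, List.foldl_cons, List.foldl_nil]
  simpa using foldl_take _ le_rfl

theorem computable_list_flatMap {f : α → List β} {g : α → β → List γ} (hf : Computable f)
    (hg : Computable₂ g) : Computable fun a => (f a).flatMap (g a) := by
  refine (computable_list_foldl (h := fun a p => p.1 ++ g a p.2) hf (Computable.const [])
    (Computable.list_append.comp (Computable.fst.comp .snd)
      (hg.comp .fst (Computable.snd.comp .snd)))).of_eq fun a => ?_
  have foldl_append : ∀ (l : List β) (acc : List γ),
      l.foldl (fun s b => s ++ g a b) acc = acc ++ l.flatMap (g a) := by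
    intro l
    induction l with
    | nil => simp
    | cons b l ih => intro acc; simp [ih]
  simpa using foldl_append (f a) []

theorem computable_list_map {f : α → List β} {g : α → β → γ} (hf : Computable f)
    (hg : Computable₂ g) : Computable fun a => (f a).map (g a) :=
  (computable_list_flatMap (g := fun a b => [g a b]) hf
    (Computable.list_cons.comp hg (Computable.const []))).of_eq fun _ => List.map_eq_flatMap.symm

@[to_additive]
theorem computable_list_prod [CommMonoid γ] (hmul : Computable₂ fun a b : γ => a * b)
    {f : α → List γ} (hf : Computable f) : Computable fun a => (f a).prod :=
  (computable_list_foldl (h := fun _ p => p.1 * p.2) hf (Computable.const 1)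
    (hmul.comp (Computable.fst.comp .snd) (Computable.snd.comp .snd))).of_eq fun _ =>
      List.prod_eq_foldl.symm

theorem computable_prod_range [CommMonoid γ] (hmul : Computable₂ fun a b : γ => a * b)
    {n : α → ℕ} {f : α → ℕ → γ} (hn : Computable n) (hf : Computable₂ f) :
    Computable fun a => ∏ k ∈ Finset.range (n a), f a k :=
  (computable_list_prod hmul
    (computable_list_map (Primrec.list_range.to_comp.comp hn) hf)).of_eq fun _ => rfl

theorem computable_pow [CommMonoid γ] (hmul : Computable₂ fun a b : γ => a * b)
    {f : α → γ} {n : α → ℕ} (hf : Computable f) (hn : Computable n) :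
    Computable fun a => f a ^ n a :=
  (computable_prod_range hmul hn (hf.comp .fst).to₂).of_eq fun a => by simp

@[to_additive]
theorem computable_finset_prod [CommMonoid γ] (hmul : Computable₂ fun a b : γ => a * b)
    {ι : Type*} (t : Finset ι) {f : ι → α → γ} (hf : ∀ i, Computable (f i)) :
    Computable fun a => ∏ i ∈ t, f i a := by
  classical
  induction t using Finset.induction_on with
  | empty => simpa using Computable.const 1
  | insert i t hi ih => simpa [Finset.prod_insert hi] using hmul.comp (hf i) ih

theorem computable_ite {p : α → Prop} [DecidablePred p] (hp : ComputablePred p)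
    {f g : α → γ} (hf : Computable f) (hg : Computable g) :
    Computable fun a => if p a then f a else g a :=
  (Computable.cond hp.decide hf hg).of_eq fun a => by by_cases h : p a <;> simp [h]

theorem computablePred_comp {p : β → Prop} (hp : ComputablePred p) {f : α → β}
    (hf : Computable f) : ComputablePred fun a => p (f a) := by
  classical
  exact (hp.decide.comp hf).computablePred

theorem computablePred_and {p q : α → Prop} (hp : ComputablePred p) (hq : ComputablePred q) :
    ComputablePred fun a => p a ∧ q a := by
  classical
  exact ((Primrec.and.to_comp.comp hp.decide hq.decide).of_eq fun a => by simp).computablePred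

theorem computablePred_eq {f g : α → β} (hf : Computable f) (hg : Computable g) :
    ComputablePred fun a => f a = g a :=
  computablePred_comp (p := fun q : β × β => q.1 = q.2)
    (PrimrecPred.computablePred Primrec.eq) (hf.pair hg)

theorem computablePred_ne {f g : α → β} (hf : Computable f) (hg : Computable g) :
    ComputablePred fun a => f a ≠ g a :=
  (computablePred_eq hf hg).not

theorem computablePred_le {f g : α → ℕ} (hf : Computable f) (hg : Computable g) :
    ComputablePred fun a => f a ≤ g a :=
  computablePred_comp (p := fun q : ℕ × ℕ => q.1 ≤ q.2)
    (PrimrecPred.computablePred Primrec.nat_le) (hf.pair hg)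

theorem computablePred_lt {f g : α → ℕ} (hf : Computable f) (hg : Computable g) :
    ComputablePred fun a => f a < g a :=
  computablePred_le (Computable.succ.comp hf) hg

theorem computablePred_forall_mem_list {f : α → List β} {p : α → β → Prop} (hf : Computable f)
    (hp : ComputablePred fun q : α × β => p q.1 q.2) :
    ComputablePred fun a => ∀ b ∈ f a, p a b := by
  classical
  have counterexamples : Computable fun a => (f a).flatMap fun b => if p a b then [] else [b] :=
    computable_list_flatMap hf
      (computable_ite (p := fun q : α × β => p q.1 q.2) hp (Computable.const [])
        (Computable.list_cons.comp .snd (Computable.const [])))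
  exact (computablePred_eq counterexamples (Computable.const [])).of_eq fun a => by
    simp [List.flatMap_eq_nil_iff]

theorem computablePred_forall_lt {n : α → ℕ} {p : α → ℕ → Prop} (hn : Computable n)
    (hp : ComputablePred fun q : α × ℕ => p q.1 q.2) :
    ComputablePred fun a => ∀ k < n a, p a k :=
  (computablePred_forall_mem_list (Primrec.list_range.to_comp.comp hn) hp).of_eq fun a => by simp

theorem exists_partrec_uniformization {R : α → β → Prop}
    (hR : ComputablePred fun q : α × β => R q.1 q.2) :
    ∃ f : α →. β, Partrec f ∧ ∀ a, (∃ b, R a b) → ∃ b ∈ f a, R a b := by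
  classical
  have test : Computable₂ fun (a : α) (b : β) => if R a b then some b else Option.none :=
    computable_ite (p := fun q : α × β => R q.1 q.2) hR
      (Computable.option_some.comp .snd) (Computable.const Option.none)
  refine ⟨_, Partrec.rfindOpt (Computable.bind_decode_iff.2 test), fun a ⟨b, hb⟩ => ?_⟩
  have hdom := Nat.rfindOpt_dom (f := fun n => (Encodable.decode (α := β) n).bind
    fun b => if R a b then some b else Option.none) |>.2 ⟨Encodable.encode b, b, by simp [hb]⟩
  refine ⟨_, Part.get_mem hdom, ?_⟩
  obtain ⟨n, hn⟩ := Nat.rfindOpt_spec (Part.get_mem hdom)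
  simp only [Option.mem_def, Option.bind_eq_some_iff, Option.ite_none_right_eq_some,
    Option.some.injEq] at hn
  obtain ⟨b', -, h, h'⟩ := hn
  rwa [← h']

theorem primrec_int_ofNat : Primrec fun n : ℕ => (n : ℤ) :=
  Primrec.encode_iff.1 (Primrec.nat_double.of_eq fun _ => rfl)

theorem primrec_int_negSucc : Primrec Int.negSucc :=
  Primrec.encode_iff.1 (Primrec.nat_double_succ.of_eq fun _ => rfl)

-- The codes of `n` and `-n - 1` are `2 * n` and `2 * n + 1`.
theorem primrec_int_toNat : Primrec Int.toNat := by
  refine ((Primrec.cond (Primrec.nat_bodd.comp Primrec.encode) (Primrec.const 0)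
    (Primrec.nat_div2.comp Primrec.encode)) : Primrec fun z : ℤ =>
      cond (Encodable.encode z).bodd 0 (Encodable.encode z).div2).of_eq fun z => ?_
  rcases z with n | n
  · change cond (Nat.bodd (2 * n)) 0 (Nat.div2 (2 * n)) = n
    simp [Nat.div2_val]
  · change cond (Nat.bodd (2 * n + 1)) 0 (Nat.div2 (2 * n + 1)) = 0
    simp

theorem primrec_int_toNat_neg : Primrec fun z : ℤ => (-z).toNat := by
  refine ((Primrec.cond (Primrec.nat_bodd.comp Primrec.encode)
    (Primrec.succ.comp (Primrec.nat_div2.comp Primrec.encode)) (Primrec.const 0)) :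
      Primrec fun z : ℤ =>
        cond (Encodable.encode z).bodd (Encodable.encode z).div2.succ 0).of_eq fun z => ?_
  rcases z with n | n
  · change cond (Nat.bodd (2 * n)) (Nat.div2 (2 * n)).succ 0 = _
    simp
  · change cond (Nat.bodd (2 * n + 1)) (Nat.div2 (2 * n + 1)).succ 0 = _
    simp [Nat.div2_val]

theorem primrec_int_subNatNat : Primrec₂ Int.subNatNat := by
  refine (Primrec.nat_casesOn (Primrec.nat_sub.comp Primrec.snd Primrec.fst)
    (primrec_int_ofNat.comp (Primrec.nat_sub.comp Primrec.fst Primrec.snd))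
    (primrec_int_negSucc.comp Primrec.snd).to₂).of_eq fun p => ?_
  rw [Int.subNatNat]
  cases p.2 - p.1 <;> rfl

theorem primrec_int_add : Primrec₂ fun a b : ℤ => a + b := by
  refine (primrec_int_subNatNat.comp
    (Primrec.nat_add.comp (primrec_int_toNat.comp Primrec.fst) (primrec_int_toNat.comp Primrec.snd))
    (Primrec.nat_add.comp (primrec_int_toNat_neg.comp Primrec.fst)
      (primrec_int_toNat_neg.comp Primrec.snd))).of_eq fun p => ?_
  rw [Int.subNatNat_eq_coe]
  change _ = p.1 + p.2
  omega

theorem primrec_fin_eval {k : ℕ} (i : Fin k) : Primrec fun m : Fin k → γ => m i :=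
  Primrec.fin_app.comp Primrec.id (Primrec.const i)

theorem primrec_fin_comp {k l : ℕ} (e : Fin l → Fin k) :
    Primrec fun (m : Fin k → γ) (j : Fin l) => m (e j) :=
  Primrec.fin_curry.2 (Primrec.fin_app.comp Primrec.fst ((Primrec.dom_finite e).comp Primrec.snd))

theorem primrec_fin_add [Add γ] (hadd : Primrec₂ fun a b : γ => a + b) {k : ℕ} :
    Primrec₂ fun a b : Fin k → γ => a + b := by
  refine (Primrec.fin_curry (f := fun (p : (Fin k → γ) × (Fin k → γ)) i => p.1 i + p.2 i)).2 ?_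
  exact hadd.comp
    (Primrec.fin_app.comp (Primrec.fst.comp Primrec.fst) Primrec.snd)
    (Primrec.fin_app.comp (Primrec.snd.comp Primrec.fst) Primrec.snd)

end Computability

/-! ### Laurent monomials -/

section LaurentMonomial

variable {A B : Type*} [CommRing A] [CommRing B] {k : ℕ}

theorem map_laurentMonomial (f : A →+* B) (x : Fin k → Aˣ) (m : Fin k → ℤ) :
    f (laurentMonomial x m) = laurentMonomial (fun i => Units.map (f : A →* B) (x i)) m := by
  simp only [laurentMonomial, ← map_zpow, ← map_prod]
  rfl

theorem laurentMonomial_zero (x : Fin k → Aˣ) : laurentMonomial x 0 = 1 := by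
  simp [laurentMonomial]

theorem laurentMonomial_add (x : Fin k → Aˣ) (m m' : Fin k → ℤ) :
    laurentMonomial x (m + m') = laurentMonomial x m * laurentMonomial x m' := by
  simp only [laurentMonomial, ← Units.val_mul, ← Finset.prod_mul_distrib, Pi.add_apply, zpow_add]

theorem laurentMonomial_mul (x y : Fin k → Aˣ) (m : Fin k → ℤ) :
    laurentMonomial (fun i => x i * y i) m = laurentMonomial x m * laurentMonomial y m := by
  simp only [laurentMonomial, ← Units.val_mul, ← Finset.prod_mul_distrib, mul_zpow]

theorem laurentMonomial_single (x : Fin k → Aˣ) (i : Fin k) (z : ℤ) :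
    laurentMonomial x (Pi.single i z) = ((x i ^ z : Aˣ) : A) := by
  rw [laurentMonomial, Finset.prod_eq_single i (fun j _ hj => by simp [Pi.single_eq_of_ne hj])
    (by simp), Pi.single_eq_same]

theorem laurentMonomial_eq_prod_zpow {F : Type*} [Field F] (w : Fin k → Fˣ) (m : Fin k → ℤ) :
    laurentMonomial w m = ∏ i, (w i : F) ^ m i := by
  simp [laurentMonomial, Units.coe_prod]

theorem laurentMonomial_eq_castAdd_mul_natAdd {u s : ℕ} (x : Fin (u + s) → Aˣ)
    (m : Fin (u + s) → ℤ) :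
    laurentMonomial x m =
      laurentMonomial (fun i => x (Fin.castAdd s i)) (fun i => m (Fin.castAdd s i)) *
      laurentMonomial (fun j => x (Fin.natAdd u j)) (fun j => m (Fin.natAdd u j)) := by
  simp only [laurentMonomial, ← Units.val_mul, Fin.prod_univ_add]

theorem aut_laurentMonomial [Algebra A B] (σB : B ≃+* B) {x : Fin k → Bˣ} {α : Fin k → Aˣ}
    (h : ∀ i, σB (x i) = algebraMap A B (α i) * x i) (m : Fin k → ℤ) :
    σB (laurentMonomial x m) = algebraMap A B (laurentMonomial α m) * laurentMonomial x m := by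
  have map_gen : (fun i => Units.map (σB : B →+* B).toMonoidHom (x i)) =
      fun i => Units.map (algebraMap A B).toMonoidHom (α i) * x i := by
    funext i
    ext
    simpa using h i
  rw [map_laurentMonomial (algebraMap A B), ← laurentMonomial_mul]
  exact (map_laurentMonomial (σB : B →+* B) x m).trans
    (congrArg (fun y => laurentMonomial y m) map_gen)

end LaurentMonomial

/-! ### Rings whose elements are given by lists of terms -/

section TermLists

variable {F : Type*} [CommRing F] {I I' J A B : Type*} [CommRing A] [CommRing B]

/-- The element `∑ ι a * mon i` given by a list of terms `(a, i)`: `laurentRep` and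
`laurentRootRep` are the instances where `mon i` is a Laurent monomial, resp. a Laurent monomial
times a power of `z`. -/
def termRep (ι : F →+* A) (mon : I → A) (t : List (F × I)) : A :=
  (t.map fun p => ι p.1 * mon p.2).sum

/-- The coefficients of a list of terms with respect to a basis indexed by `J`, where `r i` is the
index of the basis element which the `i`-th monomial is equal to. -/
noncomputable def termCoeff (r : I → J) (t : List (F × I)) : J →₀ F :=
  (t.map fun p => Finsupp.single (r p.2) p.1).sum

theorem termRep_cons (ι : F →+* A) (mon : I → A) (p : F × I) (t : List (F × I)) :
    termRep ι mon (p :: t) = ι p.1 * mon p.2 + termRep ι mon t := by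
  simp [termRep]

theorem termRep_append (ι : F →+* A) (mon : I → A) (t t' : List (F × I)) :
    termRep ι mon (t ++ t') = termRep ι mon t + termRep ι mon t' := by
  simp [termRep]

theorem mul_termRep (ι : F →+* A) {mon : I → A} {a : F} {y : A} {f : I → I}
    (hf : ∀ i, y * mon i = mon (f i)) (t : List (F × I)) :
    ι a * y * termRep ι mon t = termRep ι mon (t.map fun q => (a * q.1, f q.2)) := by
  rw [termRep, termRep, ← List.sum_map_mul_left, List.map_map]
  congr 1
  refine List.map_congr_left fun q _ => ?_
  simp only [Function.comp, map_mul, ← hf]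
  ring

theorem termRep_mul_termRep (ι : F →+* A) {mon : I → A} {op : I → I → I}
    (hmul : ∀ i j, mon i * mon j = mon (op i j)) (t t' : List (F × I)) :
    termRep ι mon (t.flatMap fun p => t'.map fun q => (p.1 * q.1, op p.2 q.2)) =
      termRep ι mon t * termRep ι mon t' := by
  induction t with
  | nil => simp [termRep]
  | cons p t ih =>
    rw [List.flatMap_cons, termRep_append, ih, termRep_cons, add_mul, mul_termRep ι (hmul p.2)]

theorem termRep_surjective [Algebra F A] {mon : I → A}
    (hspan : Submodule.span F (Set.range mon) = ⊤) :
    Function.Surjective (termRep (algebraMap F A) mon) := by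
  intro a
  have ha : a ∈ Submodule.span F (Set.range mon) := hspan ▸ Submodule.mem_top
  induction ha using Submodule.span_induction with
  | mem y hy =>
    obtain ⟨i, rfl⟩ := hy
    exact ⟨[(1, i)], by simp [termRep]⟩
  | zero => exact ⟨[], rfl⟩
  | add y z _ _ hy hz =>
    obtain ⟨t, rfl⟩ := hy
    obtain ⟨t', rfl⟩ := hz
    exact ⟨t ++ t', termRep_append ..⟩
  | smul c y _ hy =>
    obtain ⟨t, rfl⟩ := hy
    refine ⟨t.map fun q => (c * q.1, q.2), ?_⟩
    rw [Algebra.smul_def, ← mul_one (algebraMap F A c),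
      mul_termRep (algebraMap F A) (f := id) fun i => one_mul _]
    rfl

theorem termRep_eq_linearCombination [Algebra F A] {mon : I → A} {b : J → A} {r : I → J}
    (hb : ∀ i, mon i = b (r i)) (t : List (F × I)) :
    termRep (algebraMap F A) mon t = Finsupp.linearCombination F b (termCoeff r t) := by
  simp only [termRep, termCoeff, map_list_sum, List.map_map]
  congr 1
  exact List.map_congr_left fun q _ => by simp [hb, Algebra.smul_def]

theorem termCoeff_apply [DecidableEq J] (r : I → J) (t : List (F × I)) (j : J) :
    termCoeff r t j = (t.map fun q => if r q.2 = j then q.1 else 0).sum := by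
  have eval_sum := map_list_sum (Finsupp.applyAddHom (M := F) j)
    (t.map fun p => Finsupp.single (r p.2) p.1)
  simpa [termCoeff, Function.comp_def, Finsupp.single_apply] using eval_sum

theorem termCoeff_eq_zero {r : I → J} {t : List (F × I)} {j : J} (h : ∀ q ∈ t, r q.2 ≠ j) :
    termCoeff r t j = 0 := by
  classical
  rw [termCoeff_apply]
  refine List.sum_eq_zero fun y hy => ?_
  obtain ⟨q, hq, rfl⟩ := List.mem_map.1 hy
  exact if_neg (h q hq)

theorem termCoeff_eq_iff {r : I → J} {t t' : List (F × I)} :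
    termCoeff r t = termCoeff r t' ↔
      ∀ q ∈ t ++ t', termCoeff r t (r q.2) = termCoeff r t' (r q.2) := by
  refine ⟨fun h q _ => by rw [h], fun h => Finsupp.ext fun j => ?_⟩
  by_cases hj : ∃ q ∈ t ++ t', r q.2 = j
  · obtain ⟨q, hq, rfl⟩ := hj
    exact h q hq
  · push Not at hj
    rw [termCoeff_eq_zero fun q hq => hj q (List.mem_append_left _ hq),
      termCoeff_eq_zero fun q hq => hj q (List.mem_append_right _ hq)]

variable [Primcodable F] [Primcodable I] [Primcodable I'] [Primcodable J]

theorem computable_termCoeff (hadd : Computable₂ fun a b : F => a + b) {r : I → J}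
    (hr : Computable r) : Computable₂ fun (t : List (F × I)) j => termCoeff r t j := by
  classical
  refine (computable_list_sum hadd (computable_list_map .fst
    (computable_ite (p := fun q : (List (F × I) × J) × (F × I) => r q.2.2 = q.1.2)
      (computablePred_eq (hr.comp (Computable.snd.comp .snd)) (Computable.snd.comp .fst))
      (Computable.fst.comp .snd) (Computable.const 0)).to₂)).of_eq fun p => ?_
  exact (termCoeff_apply r p.1 p.2).symm

theorem computablePred_termRep_eq [Algebra F A] (hadd : Computable₂ fun a b : F => a + b)
    {mon : I → A} {b : J → A} {r : I → J} (hr : Computable r) (hb : ∀ i, mon i = b (r i))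
    (hind : LinearIndependent F b) :
    ComputablePred fun p : List (F × I) × List (F × I) =>
      termRep (algebraMap F A) mon p.1 = termRep (algebraMap F A) mon p.2 := by
  have coeffs : ComputablePred fun p : List (F × I) × List (F × I) =>
      ∀ q ∈ p.1 ++ p.2, termCoeff r p.1 (r q.2) = termCoeff r p.2 (r q.2) :=
    computablePred_forall_mem_list (Computable.list_append.comp .fst .snd)
      (computablePred_eq
        ((computable_termCoeff hadd hr).comp (Computable.fst.comp .fst)
          (hr.comp (Computable.snd.comp .snd)))
        ((computable_termCoeff hadd hr).comp (Computable.snd.comp .fst)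
          (hr.comp (Computable.snd.comp .snd))))
  refine coeffs.of_eq fun p => ?_
  rw [termRep_eq_linearCombination hb, termRep_eq_linearCombination hb, hind.eq_iff,
    termCoeff_eq_iff]

theorem computable_termMul (hmul : Computable₂ fun a b : F => a * b) {op : I → I → I}
    (hop : Computable₂ op) :
    Computable₂ fun t t' : List (F × I) =>
      t.flatMap fun p => t'.map fun q => (p.1 * q.1, op p.2 q.2) := by
  have term_mul : Computable₂ fun (p : (List (F × I) × List (F × I)) × (F × I)) (q : F × I) =>
      (p.2.1 * q.1, op p.2.2 q.2) :=
    (hmul.comp (Computable.fst.comp (Computable.snd.comp .fst)) (Computable.fst.comp .snd)).pair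
      (hop.comp (Computable.snd.comp (Computable.snd.comp .fst)) (Computable.snd.comp .snd))
  exact computable_list_flatMap .fst (computable_list_map (Computable.snd.comp .fst) term_mul).to₂

theorem computableVia_termRep (hmul : Computable₂ fun a b : F => a * b) {ιA : F →+* A}
    {ιB : F →+* B} {mon : I → A} {mon' : I' → B} {θ : F → F} (hθ : Computable θ) (φ : A →+* B)
    (hι : ∀ a, φ (ιA a) = ιB (θ a)) {χ : I → F} (hχ : Computable χ) {p : I → I'}
    (hp : Computable p) (hmon : ∀ i, φ (mon i) = ιB (χ i) * mon' (p i)) :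
    ComputableVia (termRep ιA mon) (termRep ιB mon') φ := by
  refine ⟨fun t => t.map fun q => (θ q.1 * χ q.2, p q.2),
    computable_list_map Computable.id ((hmul.comp (hθ.comp (Computable.fst.comp .snd))
      (hχ.comp (Computable.snd.comp .snd))).pair (hp.comp (Computable.snd.comp .snd))).to₂,
    fun t => ?_⟩
  simp only [termRep, map_list_sum, List.map_map]
  congr 1
  exact List.map_congr_left fun q _ => by simp [hι, hmon, mul_assoc]

end TermLists

section ComputableExtensions

variable {F : Type*} [Field F] [Primcodable F] {I J A : Type*} [Primcodable I] [Primcodable J]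
  [CommRing A]

theorem isComputableDiffRing_termRep {σ : F ≃+* F} (hF : IsComputableDiffField σ) [Algebra F A]
    {mon : I → A} {b : J → A} {r : I → J} (hr : Computable r) (hb : ∀ i, mon i = b (r i))
    (hind : LinearIndependent F b) (hspan : Submodule.span F (Set.range mon) = ⊤)
    {op : I → I → I} (hop : Computable₂ op) (hmul : ∀ i j, mon i * mon j = mon (op i j))
    (σA : A ≃+* A) (hσ : ∀ a, σA (algebraMap F A a) = algebraMap F A (σ a)) {χ : I → F}
    (hχ : Computable χ) (hmon : ∀ i, σA (mon i) = algebraMap F A (χ i) * mon i) :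
    IsComputableDiffRing (termRep (algebraMap F A) mon) σA where
  surjective := termRep_surjective hspan
  eq := computablePred_termRep_eq hF.add hr hb hind
  add := ⟨_, Computable.list_append, termRep_append _ mon⟩
  mul := ⟨_, computable_termMul hF.mul hop, termRep_mul_termRep _ hmul⟩
  aut := computableVia_termRep hF.mul hF.aut (σA : A →+* A) hσ hχ Computable.id hmon

theorem computable_zpow {G : Type*} [DivisionCommMonoid G] [Primcodable G]
    (hmul : Computable₂ fun a b : G => a * b) (a : G) : Computable fun z : ℤ => a ^ z := by
  refine (hmul.comp
    (computable_pow hmul (Computable.const a) primrec_int_toNat.to_comp)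
    (computable_pow hmul (Computable.const a⁻¹) primrec_int_toNat_neg.to_comp)).of_eq fun z => ?_
  rcases z with n | n
  · simp
  · simp [zpow_negSucc]

theorem computable_laurentMonomial (hmul : Computable₂ fun a b : F => a * b) {k : ℕ}
    (w : Fin k → Fˣ) : Computable fun m : Fin k → ℤ => laurentMonomial w m :=
  (computable_finset_prod hmul _ fun i => (computable_zpow hmul (w i : F)).comp
    (primrec_fin_eval i).to_comp).of_eq fun m => (laurentMonomial_eq_prod_zpow w m).symm

theorem IsPExtension.isComputableDiffRing {E : Type*} [CommRing E] [Algebra F E] {σ : F ≃+* F}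
    {σE : E ≃+* E} {k : ℕ} {x : Fin k → Eˣ} {α : Fin k → Fˣ} (h : IsPExtension σ σE x α)
    (hF : IsComputableDiffField σ) : IsComputableDiffRing (laurentRep (F := F) x) σE :=
  isComputableDiffRing_termRep hF Computable.id (fun _ => rfl) h.linearIndependent h.span_eq_top
    (primrec_fin_add primrec_int_add).to_comp (fun m m' => (laurentMonomial_add x m m').symm)
    σE h.extends_aut (computable_laurentMonomial hF.mul α) (aut_laurentMonomial σE h.shift_gen)

end ComputableExtensions

section RootMonomial

variable {E B : Type*} [CommRing E] [CommRing B] [Algebra E B] {k : ℕ}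

/-- The element `x₁^{m₁}⋯x_k^{m_k} z^e` of `E[z]`, where `p = (m, e)`. -/
def rootMonomial (x : Fin k → Eˣ) (z : B) (p : (Fin k → ℤ) × ℕ) : B :=
  algebraMap E B (laurentMonomial x p.1) * z ^ p.2

theorem rootMonomial_add (x : Fin k → Eˣ) (z : B) (p q : (Fin k → ℤ) × ℕ) :
    rootMonomial x z (p + q) = rootMonomial x z p * rootMonomial x z q := by
  simp only [rootMonomial, Prod.fst_add, Prod.snd_add, laurentMonomial_add, map_mul, pow_add]
  ring

theorem rootMonomial_eq_smul_pow_mod (x : Fin k → Eˣ) {z : B} {n : ℕ} [NeZero n]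
    (hz : z ^ n = 1) (p : (Fin k → ℤ) × ℕ) :
    rootMonomial x z p = laurentMonomial x p.1 • z ^ (Fin.ofNat n p.2 : ℕ) := by
  rw [rootMonomial, Algebra.smul_def, Fin.val_ofNat, ← pow_eq_pow_mod p.2 hz]

variable {F : Type*} [Field F] [Algebra F E]

theorem laurentRootRep_eq_termRep (x : Fin k → Eˣ) (z : B) :
    laurentRootRep (F := F) x z =
      termRep ((algebraMap E B).comp (algebraMap F E)) (rootMonomial x z) := by
  funext t
  simp only [laurentRootRep, termRep]
  congr 1
  exact List.map_congr_left fun q _ => by simp [rootMonomial, mul_assoc]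

theorem span_rootMonomial [Algebra F B] [IsScalarTower F E B] {x : Fin k → Eˣ} {z : B} {n : ℕ}
    (hx : Submodule.span F (Set.range (laurentMonomial x)) = ⊤)
    (hz : Submodule.span E (Set.range fun i : Fin n => z ^ (i : ℕ)) = ⊤) :
    Submodule.span F (Set.range (rootMonomial x z)) = ⊤ := by
  rw [eq_top_iff, ← Submodule.restrictScalars_top F E B, ← hz,
    ← Submodule.span_smul_of_span_eq_top hx]
  refine Submodule.span_mono ?_
  rintro _ ⟨_, ⟨m, rfl⟩, _, ⟨e, rfl⟩, rfl⟩
  exact ⟨(m, (e : ℕ)), (Algebra.smul_def _ _).symm⟩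

theorem aut_rootMonomial {σE : E ≃+* E} {σB : B ≃+* B}
    (hB : ∀ e, σB (algebraMap E B e) = algebraMap E B (σE e)) {x : Fin k → Eˣ} {α : Fin k → Fˣ}
    (hx : ∀ i, σE (x i) = algebraMap F E (α i) * x i) {z : B} {ρ : F}
    (hz : σB z = algebraMap E B (algebraMap F E ρ) * z) (p : (Fin k → ℤ) × ℕ) :
    σB (rootMonomial x z p) =
      algebraMap E B (algebraMap F E (laurentMonomial α p.1 * ρ ^ p.2)) * rootMonomial x z p := by
  simp only [rootMonomial, map_mul, map_pow, hB, hz, aut_laurentMonomial σE hx, mul_pow]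
  ring

theorem IsAExtension.isComputableDiffRing [Primcodable F] {σ : F ≃+* F} {σE : E ≃+* E}
    {σB : B ≃+* B} {x : Fin k → Eˣ} {α : Fin k → Fˣ} (h : IsPExtension σ σE x α) {z : B} {n : ℕ}
    {ρ : F} (hB : IsAExtension σE σB z n (algebraMap F E ρ)) (hF : IsComputableDiffField σ) :
    IsComputableDiffRing (laurentRootRep (F := F) x z) σB := by
  let : Algebra F B := ((algebraMap E B).comp (algebraMap F E)).toAlgebra
  have : IsScalarTower F E B := IsScalarTower.of_algebraMap_eq fun _ => rfl
  have : NeZero n := ⟨(zero_lt_one.trans hB.one_lt).ne'⟩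
  have reduce : Computable fun p : (Fin k → ℤ) × ℕ => (p.1, Fin.ofNat n p.2) :=
    Computable.fst.pair (Primrec.to_comp (Primrec.fin_val_iff.1
      (Primrec.nat_mod.comp Primrec.snd (Primrec.const n))))
  have add : Computable₂ fun p q : (Fin k → ℤ) × ℕ => p + q :=
    ((primrec_fin_add primrec_int_add).to_comp.comp (Computable.fst.comp .fst)
      (Computable.fst.comp .snd)).pair (Primrec.nat_add.to_comp.comp (Computable.snd.comp .fst)
      (Computable.snd.comp .snd))
  have multiplier : Computable fun p : (Fin k → ℤ) × ℕ => laurentMonomial α p.1 * ρ ^ p.2 :=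
    hF.mul.comp ((computable_laurentMonomial hF.mul α).comp .fst)
      (computable_pow hF.mul (Computable.const ρ) .snd)
  rw [laurentRootRep_eq_termRep]
  exact isComputableDiffRing_termRep hF reduce (rootMonomial_eq_smul_pow_mod x hB.pow_eq_one)
    (linearIndependent_smul h.linearIndependent hB.linearIndependent)
    (span_rootMonomial h.span_eq_top hB.span_eq_top) add
    (fun p q => (rootMonomial_add x z p q).symm) σB
    (fun a => (hB.extends_aut _).trans (congrArg _ (h.extends_aut a))) multiplier
    (aut_rootMonomial hB.extends_aut h.shift_gen hB.shift_gen)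

end RootMonomial

/-! ### Sequences -/

section Sequences

variable {K : Type*} [Field K]

theorem exists_eq_const_of_seqShift_eq {y : SeqRing K} (h : seqShift K y = y) :
    ∃ c : K, y = toSeq fun _ => c := by
  induction y using Germ.inductionOn with
  | _ f =>
    obtain ⟨N, hN⟩ := eventually_atTop.1 (Germ.coe_eq.1 h)
    refine ⟨f N, Germ.coe_eq.2 (eventually_atTop.2 ⟨N, fun n hn => ?_⟩)⟩
    induction n, hn using Nat.le_induction with
    | base => rfl
    | succ n hn ih => exact (hN n hn).trans ih

variable (K) in
/-- The geometric sequence `(w ^ k)_{k ≥ 0}`, as a multiplicative function of `w`. -/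
def geomSeq : K →* SeqRing K where
  toFun w := toSeq fun k => w ^ k
  map_one' := Germ.coe_eq.2 (Eventually.of_forall fun k => by simp)
  map_mul' w w' := Germ.coe_eq.2 (Eventually.of_forall fun k => by simp [mul_pow])

theorem geomSeq_injective : Function.Injective (geomSeq K) := by
  intro w w' h
  obtain ⟨N, hN⟩ := eventually_atTop.1 (Germ.coe_eq.1 h)
  have pow_eq : w ^ N = w' ^ N := hN N le_rfl
  have pow_succ_eq : w ^ (N + 1) = w' ^ (N + 1) := hN (N + 1) (Nat.le_succ N)
  by_cases hw : w = 0
  · rw [hw, zero_pow N.succ_ne_zero] at pow_succ_eq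
    rw [hw, eq_zero_of_pow_eq_zero pow_succ_eq.symm]
  · rw [pow_succ, pow_succ, ← pow_eq] at pow_succ_eq
    exact mul_left_cancel₀ (pow_ne_zero N hw) pow_succ_eq

theorem seqShift_geomSeq (w : K) :
    seqShift K (geomSeq K w) = (toSeq fun _ => w) * geomSeq K w :=
  Germ.coe_eq.2 (Eventually.of_forall fun k => by simp [pow_succ'])

theorem IsKEmbedding.exists_incl_eq {A : Type*} [CommRing A] {σA : A ≃+* A} {incl : K →+* A}
    {τ : A →+* SeqRing K} (h : IsKEmbedding σA incl τ) {b : A} (hb : σA b = b) :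
    ∃ c, incl c = b := by
  obtain ⟨c, hc⟩ := exists_eq_const_of_seqShift_eq (y := τ b) (by rw [← h.diffHom, hb])
  exact ⟨c, h.injective (by rw [h.const, hc])⟩

end Sequences

theorem IsDiffHom.ker_eq_map {A B : Type*} [CommRing A] [CommRing B] {σA : A ≃+* A}
    {σB : B ≃+* B} {f : A →+* B} (h : IsDiffHom σA σB f) :
    RingHom.ker f = (RingHom.ker f).map (σA : A →+* A) := by
  ext a
  change _ ↔ a ∈ Ideal.map σA (RingHom.ker f)
  have shift_symm : f a = σB (f (σA.symm a)) := by rw [← h, RingEquiv.apply_symm_apply]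
  rw [← Ideal.comap_symm, Ideal.mem_comap, RingHom.mem_ker, RingHom.mem_ker, shift_symm,
    map_eq_zero_iff _ σB.injective]

/-- The automorphism of `A / ker f` induced by `σA`, which makes both maps of the factorization
`A → A / ker f → B` of `f` difference ring homomorphisms. -/
def IsDiffHom.kerAut {A B : Type*} [CommRing A] [CommRing B] {σA : A ≃+* A} {σB : B ≃+* B}
    {f : A →+* B} (h : IsDiffHom σA σB f) : (A ⧸ RingHom.ker f) ≃+* (A ⧸ RingHom.ker f) :=
  Ideal.quotientEquiv (RingHom.ker f) (RingHom.ker f) σA h.ker_eq_map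

theorem IsDiffHom.kerLift {A B : Type*} [CommRing A] [CommRing B] {σA : A ≃+* A}
    {σB : B ≃+* B} {f : A →+* B} (h : IsDiffHom σA σB f) :
    IsDiffHom h.kerAut σB (RingHom.kerLift f) := by
  intro b
  obtain ⟨a, rfl⟩ := Ideal.Quotient.mk_surjective b
  exact h a

/-! ### Solutions of inequivalent first-order equations -/

theorem injective_of_linearIndependent_comp {R M N I : Type*} [Ring R] [AddCommGroup M]
    [AddCommGroup N] [Module R M] [Module R N] (f : M →ₗ[R] N) {v : I → M}
    (hspan : Submodule.span R (Set.range v) = ⊤) (hv : LinearIndependent R (f ∘ v)) :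
    Function.Injective f := by
  refine (injective_iff_map_eq_zero f).2 fun m hm => ?_
  obtain ⟨b, rfl⟩ := Finsupp.mem_span_range_iff_exists_finsupp.1
    (hspan ▸ Submodule.mem_top : m ∈ Submodule.span R (Set.range v))
  rw [linearIndependent_iff.1 hv b ((Finsupp.apply_linearCombination R f v b).symm.trans hm),
    Finsupp.sum_zero_index]

theorem linearIndependent_of_map_eq_smul {F M I : Type*} [Field F] [AddCommGroup M] [Module F M]
    {σ : F ≃+* F} (S : M →ₛₗ[(σ : F →+* F)] M) {y : I → M} {a : I → F} (hy0 : ∀ i, y i ≠ 0)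
    (ha : ∀ i, a i ≠ 0) (hy : ∀ i, S (y i) = a i • y i)
    (hinj : ∀ i j, a i / a j ∈ homogeneousGroup σ → i = j) : LinearIndependent F y := by
  classical
  refine linearIndependent_iff_finset_linearIndependent.2 fun t => ?_
  change LinearIndepOn F y t
  induction t using Finset.induction_on with
  | empty => simp
  | insert i₀ t hi₀ ih =>
    rw [Finset.coe_insert, linearIndepOn_insert (by simpa using hi₀)]
    refine ⟨ih, fun hmem => hy0 i₀ ?_⟩
    obtain ⟨f, hf⟩ := (Submodule.mem_span_image_finset_iff_exists_fun F).1 hmem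
    have shifted : ∑ i : t, (σ (f i) * a i - a i₀ * f i) • y i = 0 := by
      have apply_S : ∑ i : t, (σ (f i) * a i) • y i = a i₀ • y i₀ := by
        simpa only [map_sum, map_smulₛₗ, hy, smul_smul, RingEquiv.coe_toRingHom] using congrArg S hf
      rw [← hf, Finset.smul_sum] at apply_S
      simpa only [sub_smul, Finset.sum_sub_distrib, sub_eq_zero, smul_smul] using apply_S
    have hf0 : ∀ i : t, f i = 0 := fun i => by
      have hi : σ (f i) * a i = a i₀ * f i :=
        sub_eq_zero.1 (Fintype.linearIndependent_iff.1 ih _ shifted i)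
      by_contra hfi
      refine hi₀ (hinj i₀ i ⟨f i, hfi, ?_⟩ ▸ i.2)
      rwa [div_eq_div_iff (ha i) hfi, eq_comm]
    rw [← hf, Finset.sum_eq_zero fun i _ => by rw [hf0, zero_smul]]

/-! ### Laurent polynomial rings -/

section LaurentPolynomials

variable {A B C : Type*} [CommRing A] [CommRing B] [CommRing C] [Algebra A B] {k : ℕ}

theorem laurentMonomial_mem {S : Submonoid B} {x : Fin k → Bˣ} (hx : ∀ i, x i ∈ S.units)
    (m : Fin k → ℤ) : laurentMonomial x m ∈ S :=
  S.val_mem_of_mem_units (Subgroup.prod_mem _ fun i _ => Subgroup.zpow_mem _ (hx i) (m i))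

theorem laurentMonomial_ne_zero [Nontrivial B] (x : Fin k → Bˣ) (m : Fin k → ℤ) :
    laurentMonomial x m ≠ 0 := Units.ne_zero _

theorem map_mem_of_span_laurentMonomial {x : Fin k → Bˣ}
    (hspan : Submodule.span A (Set.range (laurentMonomial x)) = ⊤) (f : B →+* C) {R : Subring C}
    (hA : ∀ a, f (algebraMap A B a) ∈ R)
    (hx : ∀ i, Units.map (f : B →* C) (x i) ∈ R.toSubmonoid.units) (b : B) : f b ∈ R := by
  have hb : b ∈ Submodule.span A (Set.range (laurentMonomial x)) := hspan ▸ Submodule.mem_top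
  induction hb using Submodule.span_induction with
  | mem b hb =>
    obtain ⟨m, rfl⟩ := hb
    rw [map_laurentMonomial]
    exact laurentMonomial_mem (S := R.toSubmonoid) hx m
  | zero => simp
  | add b b' _ _ hb hb' => rw [map_add]; exact R.add_mem hb hb'
  | smul a b _ hb => rw [Algebra.smul_def, map_mul]; exact R.mul_mem (hA a) hb

theorem IsPExtension.symm {σA : A ≃+* A} {σB : B ≃+* B} {x : Fin k → Bˣ} {α : Fin k → Aˣ}
    (h : IsPExtension σA σB x α) :
    IsPExtension σA.symm σB.symm x fun i => (Units.mapEquiv σA.symm.toMulEquiv (α i))⁻¹ where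
  extends_aut a := by rw [RingEquiv.symm_apply_eq, h.extends_aut, σA.apply_symm_apply]
  linearIndependent := h.linearIndependent
  span_eq_top := h.span_eq_top
  shift_gen i := by
    have map_inv : σA ((Units.mapEquiv σA.symm.toMulEquiv (α i))⁻¹ : Aˣ) = ((α i)⁻¹ : Aˣ) := by
      rw [← map_inv]
      exact σA.apply_symm_apply _
    rw [RingEquiv.symm_apply_eq, map_mul, h.extends_aut, h.shift_gen, map_inv, ← mul_assoc,
      ← map_mul, Units.inv_mul, map_one, one_mul]

end LaurentPolynomials

/-! ### The subring of the last `s` variables -/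

theorem natAdd_ne_castAdd {u s : ℕ} (i : Fin u) (j : Fin s) :
    Fin.natAdd u j ≠ Fin.castAdd s i := fun h => by
  have := congrArg Fin.val h
  simp only [Fin.val_natAdd, Fin.val_castAdd] at this
  omega

section Tail

variable {F : Type*} [Field F] {H : Type*} [CommRing H] [Algebra F H] {u s : ℕ}

theorem laurentMonomial_append (x : Fin (u + s) → Hˣ) (m : Fin u → ℤ) (m' : Fin s → ℤ) :
    laurentMonomial x (Fin.append m m') = laurentMonomial (fun i => x (Fin.castAdd s i)) m *
      laurentMonomial (fun j => x (Fin.natAdd u j)) m' := by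
  rw [laurentMonomial_eq_castAdd_mul_natAdd]
  simp only [Fin.append_left, Fin.append_right]

theorem map_tailGen (x : Fin (u + s) → Hˣ) (j : Fin s) :
    Units.map ((tailRing F x).val.toRingHom : tailRing F x →* H) (tailGen F x j) =
      x (Fin.natAdd u j) := Units.ext rfl

theorem coe_laurentMonomial_tailGen (x : Fin (u + s) → Hˣ) (m : Fin s → ℤ) :
    ((laurentMonomial (tailGen F x) m : tailRing F x) : H) =
      laurentMonomial x (Fin.append 0 m) := by
  rw [laurentMonomial_append, laurentMonomial_zero, one_mul]
  exact (map_laurentMonomial (tailRing F x).val.toRingHom (tailGen F x) m).trans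
    (congrArg (laurentMonomial · m) (funext (map_tailGen (F := F) x)))

theorem range_laurentMonomial_tail (x : Fin (u + s) → Hˣ) :
    Set.range (fun m : Fin s → ℤ => laurentMonomial x (Fin.append 0 m)) =
      (tailRing F x).val.toLinearMap '' Set.range (laurentMonomial (tailGen F x)) := by
  rw [← Set.range_comp]
  exact congrArg Set.range (funext fun m => (coe_laurentMonomial_tailGen x m).symm)

theorem toSubmodule_tailRing_le_span (x : Fin (u + s) → Hˣ) :
    Subalgebra.toSubmodule (tailRing F x) ≤
      Submodule.span F (Set.range fun m : Fin s → ℤ => laurentMonomial x (Fin.append 0 m)) := by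
  rw [tailRing, Algebra.adjoin_eq_span]
  refine Submodule.span_mono fun y hy => ?_
  simp only [laurentMonomial_append, laurentMonomial_zero, one_mul]
  induction hy using Submonoid.closure_induction with
  | mem y hy =>
    obtain ⟨j, rfl | rfl⟩ := Set.mem_iUnion.1 hy
    · exact ⟨Pi.single j 1, by simp [laurentMonomial_single]⟩
    · exact ⟨Pi.single j (-1), by simp [laurentMonomial_single]⟩
  | one => exact ⟨0, laurentMonomial_zero _⟩
  | mul y y' _ _ hy hy' =>
    obtain ⟨m, rfl⟩ := hy
    obtain ⟨m', rfl⟩ := hy'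
    exact ⟨m + m', laurentMonomial_add _ m m'⟩

theorem span_laurentMonomial_tailGen (x : Fin (u + s) → Hˣ) :
    Submodule.span F (Set.range (laurentMonomial (tailGen F x))) = ⊤ := by
  refine eq_top_iff.2 fun e _ => ?_
  have he := toSubmodule_tailRing_le_span (F := F) x e.2
  rw [range_laurentMonomial_tail (F := F), ← Submodule.map_span] at he
  obtain ⟨e', he', h⟩ := he
  rwa [← Subtype.ext (a1 := e') (a2 := e) h]

theorem units_tailGen_mem (x : Fin (u + s) → Hˣ) (j : Fin s) :
    x (Fin.natAdd u j) ∈ (tailRing F x).toSubring.toSubmonoid.units :=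
  (Submonoid.mem_units_iff _ _).2
    ⟨(tailGen F x j : tailRing F x).2, ((tailGen F x j)⁻¹ : (tailRing F x)ˣ).val.2⟩

variable {σ : F ≃+* F} {σH : H ≃+* H} {x : Fin (u + s) → Hˣ} {α : Fin (u + s) → Fˣ}

theorem IsPExtension.linearIndependent_tailGen (h : IsPExtension σ σH x α) :
    LinearIndependent F (laurentMonomial (tailGen F x)) := by
  refine LinearIndependent.of_comp (tailRing F x).val.toLinearMap ?_
  have append_injective : Function.Injective (Fin.append (n := s) (0 : Fin u → ℤ)) :=
    fun m m' hm => by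
      funext j
      simpa only [Fin.append_right] using congrFun hm (Fin.natAdd u j)
  have hcomp : (tailRing F x).val.toLinearMap ∘ laurentMonomial (tailGen F x) =
      laurentMonomial x ∘ Fin.append 0 := funext (coe_laurentMonomial_tailGen x)
  rw [hcomp]
  exact h.linearIndependent.comp _ append_injective

theorem IsPExtension.map_mem_tailRing (h : IsPExtension σ σH x α) (e : tailRing F x) :
    σH e ∈ tailRing F x := by
  refine map_mem_of_span_laurentMonomial (span_laurentMonomial_tailGen (F := F) x)
    ((σH : H →+* H).comp (tailRing F x).val.toRingHom) (R := (tailRing F x).toSubring)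
    (fun a => ?_) (fun j => ?_) e
  · change σH (algebraMap F H a) ∈ tailRing F x
    rw [h.extends_aut]
    exact Subalgebra.algebraMap_mem _ _
  · have map_gen : Units.map (((σH : H →+* H).comp (tailRing F x).val.toRingHom : _ →+* H) : _ →* H)
        (tailGen F x j) =
        Units.map (algebraMap F H : F →* H) (α (Fin.natAdd u j)) * x (Fin.natAdd u j) :=
      Units.ext (h.shift_gen _)
    rw [map_gen]
    exact Subgroup.mul_mem _ ((Submonoid.mem_units_iff _ _).2
      ⟨Subalgebra.algebraMap_mem _ _, Subalgebra.algebraMap_mem _ _⟩) (units_tailGen_mem x j)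

theorem IsPExtension.exists_tail_aut (h : IsPExtension σ σH x α) :
    ∃ σE : tailRing F x ≃+* tailRing F x, ∀ e, (σE e : H) = σH e :=
  ⟨σH.restrict (tailRing F x) (tailRing F x) fun y =>
    ⟨fun hy => h.map_mem_tailRing ⟨y, hy⟩, fun hy => by
      simpa using h.symm.map_mem_tailRing ⟨σH y, hy⟩⟩, fun _ => rfl⟩

end Tail

/-! ### Consequences of the hypotheses -/

theorem mem_relModule_iff {F : Type*} [Field F] {σ : F ≃+* F} {r : ℕ} {α : Fin r → Fˣ}
    {m : Fin r → ℤ} : m ∈ relModule σ α ↔ laurentMonomial α m ∈ homogeneousGroup σ := by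
  rw [laurentMonomial_eq_prod_zpow]
  rfl

theorem sum_smul_single_castAdd {u s : ℕ} (a d : Fin u → ℤ) :
    ∑ i, a i • (Pi.single (Fin.castAdd s i) (d i) : Fin (u + s) → ℤ) =
      Fin.append (fun i => a i * d i) 0 := by
  ext l
  induction l using Fin.addCases with
  | left i => simp [Finset.sum_apply, Pi.single_apply]
  | right j => simp [Finset.sum_apply, natAdd_ne_castAdd]

namespace SpecialCase

variable {F : Type*} [Field F] {H : Type*} [CommRing H] [Algebra F H] {u s : ℕ}
  {σ : F ≃+* F} {τF : F →+* SeqRing (constField σ)} {σH : H ≃+* H}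
  {x : Fin (u + s) → Hˣ} {α : Fin (u + s) → Fˣ} {τ : H →+* SeqRing (constField σ)}
  {d : Fin u → ℕ}

theorem tau_const (h : SpecialCase σ τF σH x α τ d) (c : constField σ) :
    τ (algebraMap F H c) = toSeq fun _ => c := h.isKHom.const c

theorem d_pos (h : SpecialCase σ τF σH x α τ d) (i : Fin u) : 0 < d i :=
  Nat.pos_of_ne_zero fun h0 => h.basis_linearIndependent.ne_zero i (by simp [h0])

theorem mem_relModule (h : SpecialCase σ τF σH x α τ d) {m : Fin (u + s) → ℤ} :
    m ∈ relModule σ α ↔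
      (∀ i : Fin u, (d i : ℤ) ∣ m (Fin.castAdd s i)) ∧ ∀ j : Fin s, m (Fin.natAdd u j) = 0 := by
  rw [← h.basis_span, Submodule.mem_span_range_iff_exists_fun]
  simp only [sum_smul_single_castAdd]
  constructor
  · rintro ⟨a, rfl⟩
    simp
  · rintro ⟨hdvd, hzero⟩
    choose a ha using hdvd
    refine ⟨a, ?_⟩
    ext l
    induction l using Fin.addCases with
    | left i => simp [ha, mul_comm]
    | right j => simp [hzero]

theorem zpow_mem_homogeneousGroup_iff (h : SpecialCase σ τF σH x α τ d) (i : Fin u) (z : ℤ) :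
    (α (Fin.castAdd s i) : F) ^ z ∈ homogeneousGroup σ ↔ (d i : ℤ) ∣ z := by
  have hsingle := mem_relModule_iff (σ := σ) (α := α) (m := Pi.single (Fin.castAdd s i) z)
  rw [laurentMonomial_single, Units.val_zpow_eq_zpow_val] at hsingle
  rw [← hsingle, h.mem_relModule]
  refine ⟨fun h' => by simpa using h'.1 i, fun hz => ⟨fun i' => ?_, fun j => ?_⟩⟩
  · obtain rfl | hi := eq_or_ne i' i
    · simpa using hz
    · simp [hi]
  · simp [natAdd_ne_castAdd]

theorem linearIndependent_mk_laurentMonomial (h : SpecialCase σ τF σH x α τ d) {I : Type*}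
    {e : I → Fin (u + s) → ℤ} (he : ∀ i j, e i - e j ∈ relModule σ α → i = j) :
    LinearIndependent F fun i => Ideal.Quotient.mk (RingHom.ker τ) (laurentMonomial x (e i)) := by
  have : Nontrivial (H ⧸ RingHom.ker τ) := (RingHom.kerLift τ).domain_nontrivial
  let S : H ⧸ RingHom.ker τ →ₛₗ[(σ : F →+* F)] H ⧸ RingHom.ker τ :=
    { toFun := h.isKHom.diffHom.kerAut
      map_add' := map_add _
      map_smul' := fun a y => by
        rw [Algebra.smul_def, map_mul, Algebra.smul_def]
        exact congrArg (Ideal.Quotient.mk _ · * _) (h.isPExtension.extends_aut a) }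
  refine linearIndependent_of_map_eq_smul S (a := fun i => laurentMonomial α (e i))
    (fun i => (map_laurentMonomial _ x (e i)).trans_ne (laurentMonomial_ne_zero _ _))
    (fun i => laurentMonomial_ne_zero α (e i)) (fun i => ?_)
    fun i j hij => he i j (mem_relModule_iff.2 ?_)
  · rw [Algebra.smul_def]
    exact congrArg (Ideal.Quotient.mk _) (aut_laurentMonomial σH h.isPExtension.shift_gen (e i))
  · have hadd := laurentMonomial_add α (e i - e j) (e j)
    rw [sub_add_cancel] at hadd
    rwa [eq_div_of_mul_eq (laurentMonomial_ne_zero α (e j)) hadd.symm]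

theorem tailTau_injective (h : SpecialCase σ τF σH x α τ d) :
    Function.Injective (tailTau (F := F) x τ) := by
  let toQuot : tailRing F x →ₐ[F] H ⧸ RingHom.ker τ :=
    (Ideal.Quotient.mkₐ F (RingHom.ker τ)).comp (tailRing F x).val
  have toQuot_injective : Function.Injective toQuot := by
    have hcomp : toQuot.toLinearMap ∘ laurentMonomial (tailGen F x) = fun m =>
        Ideal.Quotient.mk _ (laurentMonomial x (Fin.append 0 m)) :=
      funext fun m => congrArg (Ideal.Quotient.mk _) (coe_laurentMonomial_tailGen x m)
    refine injective_of_linearIndependent_comp toQuot.toLinearMap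
      (span_laurentMonomial_tailGen x) ?_
    rw [hcomp]
    exact h.linearIndependent_mk_laurentMonomial fun m m' hm => funext fun j => by
      simpa [sub_eq_zero] using (h.mem_relModule.1 hm).2 j
  exact (RingHom.kerLift_injective τ).comp toQuot_injective

theorem tailStatement (h : SpecialCase σ τF σH x α τ d) {σE : tailRing F x ≃+* tailRing F x}
    (hσE : ∀ e, (σE e : H) = σH e) : TailStatement σ σH x α τ σE := by
  have hemb : IsKEmbedding σE (constIncl σ (tailRing F x)) (tailTau x τ) :=
    { diffHom := fun e => (congrArg τ (hσE e)).trans (h.isKHom.diffHom e)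
      const := h.tau_const
      injective := h.tailTau_injective }
  exact
    { restrict_aut := hσE
      isKEmbedding := hemb
      isPiExtension :=
        { extends_aut := fun a => Subtype.ext ((hσE _).trans (h.isPExtension.extends_aut a))
          linearIndependent := h.isPExtension.linearIndependent_tailGen
          span_eq_top := span_laurentMonomial_tailGen x
          shift_gen := fun j => Subtype.ext ((hσE _).trans (h.isPExtension.shift_gen _))
          noNewConstants := fun b hb =>
            let ⟨c, hc⟩ := hemb.exists_incl_eq hb
            ⟨c, c.2, hc⟩ } }

end SpecialCase

/-! ### The values of `τ` at the first `u` generators -/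

theorem exists_eq_const_mul_of_seqShift_eq_mul {K : Type*} [Field K] {a y w : SeqRing K}
    (hunit : IsUnit w) (hy : seqShift K y = a * y) (hw : seqShift K w = a * w) :
    ∃ c : K, y = (toSeq fun _ => c) * w := by
  obtain ⟨w, rfl⟩ := hunit
  have fixed : seqShift K (y * (w⁻¹ : (SeqRing K)ˣ)) = y * (w⁻¹ : (SeqRing K)ˣ) := by
    refine (w.isUnit.map (seqShift K)).mul_left_injective ?_
    change _ * _ = _ * _
    rw [← map_mul, Units.inv_mul_cancel_right, hy, hw, mul_left_comm, Units.inv_mul_cancel_right]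
  obtain ⟨c, hc⟩ := exists_eq_const_of_seqShift_eq fixed
  exact ⟨c, by rw [← hc, Units.inv_mul_cancel_right]⟩

section Reduction

variable {F : Type*} [Field F] {H : Type*} [CommRing H] [Algebra F H] {u s : ℕ}
  {σ : F ≃+* F} {τF : F →+* SeqRing (constField σ)} {σH : H ≃+* H}
  {x : Fin (u + s) → Hˣ} {α : Fin (u + s) → Fˣ} {τ : H →+* SeqRing (constField σ)}
  {d : Fin u → ℕ} {n : ℕ} {ρ : constField σ} {ν : Fin u → ℕ} {g : Fin u → Fˣ}
  {c : Fin u → constField σ}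

/-- Elements `ρ, νᵢ, ḡᵢ, cᵢ` as in (2a) and (2b), described through `τ` alone. The case (2a) is
`n = 1`, where `ρ = 1` and `νᵢ = 0`. -/
structure IsReduction (σ : F ≃+* F) (x : Fin (u + s) → Hˣ) (α : Fin (u + s) → Fˣ)
    (τ : H →+* SeqRing (constField σ)) (d : Fin u → ℕ) (n : ℕ) (ρ : constField σ) (ν : Fin u → ℕ)
    (g : Fin u → Fˣ) (c : Fin u → constField σ) : Prop where
  rho_pow : ρ ^ n = 1
  nu_lt : ∀ i, ν i < n
  shift_g : ∀ i, σ (g i) = (ρ : F) ^ ν i * α (Fin.castAdd s i) * g i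
  rho_nu_pow : ∀ i, (ρ ^ ν i) ^ d i = 1
  c_ne_zero : ∀ i, c i ≠ 0
  tau_gen : ∀ i, τ (x (Fin.castAdd s i)) =
    τ (algebraMap F H (c i * g i)) * geomSeq _ (ρ ^ (n - ν i))

namespace SpecialCase

theorem orderOf_eq (h : SpecialCase σ τF σH x α τ d) {i : Fin u} {ω : constField σ} {g : F}
    (hg : g ≠ 0) (hω : σ g = ω * α (Fin.castAdd s i) * g) (hd : ω ^ d i = 1) :
    orderOf ω = d i := by
  refine Nat.dvd_antisymm (orderOf_dvd_of_pow_eq_one hd) ?_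
  rw [← Int.natCast_dvd_natCast, ← h.zpow_mem_homogeneousGroup_iff, zpow_natCast]
  refine ⟨g ^ orderOf ω, pow_ne_zero _ hg, ?_⟩
  have hpow : (ω : F) ^ orderOf ω = 1 := congrArg Subtype.val (pow_orderOf_eq_one ω)
  rw [map_pow, hω, mul_pow, mul_pow, hpow, one_mul, mul_div_cancel_right₀ _ (pow_ne_zero _ hg)]

theorem exists_root_mul_mem_homogeneousGroup (h : SpecialCase σ τF σH x α τ d)
    (hσ : RadicalStable σ) (i : Fin u) :
    ∃ (ω : constField σ) (g : Fˣ), ω ^ d i = 1 ∧ σ g = ω * α (Fin.castAdd s i) * g := by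
  have hmem := (h.zpow_mem_homogeneousGroup_iff i (d i)).2 dvd_rfl
  rw [zpow_natCast] at hmem
  obtain ⟨ω, hω, hpow, g, hg, hgω⟩ := hσ _ _ (Units.ne_zero _) (h.d_pos i) hmem
  refine ⟨⟨ω, hω⟩, Units.mk0 g hg, Subtype.ext hpow, ?_⟩
  rw [Units.val_mk0, mul_comm ω, hgω, div_mul_cancel₀ _ hg]

theorem exists_tau_gen_eq (h : SpecialCase σ τF σH x α τ d) (hρ : ρ ^ n = 1) {i : Fin u} {e : ℕ}
    (he : e ≤ n) {g : Fˣ} (hg : σ g = (ρ : F) ^ e * α (Fin.castAdd s i) * g) :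
    ∃ c : constField σ, c ≠ 0 ∧ τ (x (Fin.castAdd s i)) =
      τ (algebraMap F H (c * g)) * geomSeq _ (ρ ^ (n - e)) := by
  have hroot : ρ ^ (n - e) * ρ ^ e = 1 := by rw [← pow_add, Nat.sub_add_cancel he, hρ]
  obtain ⟨c, hc⟩ := exists_eq_const_mul_of_seqShift_eq_mul
    (a := τ (algebraMap F H (α (Fin.castAdd s i)))) (y := τ (x (Fin.castAdd s i)))
    (w := τ (algebraMap F H g) * geomSeq _ (ρ ^ (n - e)))
    ((g.isUnit.map (τ.comp (algebraMap F H))).mul ((IsUnit.of_mul_eq_one _ hroot).map (geomSeq _)))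
    (by rw [← h.isKHom.diffHom, h.isPExtension.shift_gen, map_mul]) (by
      have hroot' : (ρ : F) ^ e * ((ρ ^ (n - e) : constField σ) : F) = 1 :=
        congrArg Subtype.val ((mul_comm _ _).trans hroot)
      rw [map_mul, ← h.isKHom.diffHom, h.isPExtension.extends_aut, hg, seqShift_geomSeq,
        ← h.tau_const, ← mul_assoc, ← map_mul, ← map_mul, ← mul_assoc, ← map_mul, ← map_mul]
      congr 3
      linear_combination (α (Fin.castAdd s i) : F) * g * hroot')
  have tau_gen : τ (x (Fin.castAdd s i)) =
      τ (algebraMap F H (c * g)) * geomSeq _ (ρ ^ (n - e)) := by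
    rw [hc, map_mul, map_mul, h.tau_const, mul_assoc]
  refine ⟨c, fun h0 => ((x (Fin.castAdd s i)).isUnit.map τ).ne_zero ?_, tau_gen⟩
  rw [tau_gen, h0, ZeroMemClass.coe_zero, zero_mul, map_zero, map_zero, zero_mul]

theorem exists_isReduction (h : SpecialCase σ τF σH x α τ d) (hσ : RadicalStable σ) (hu : 0 < u) :
    ∃ (ρ : constField σ) (ν : Fin u → ℕ) (g : Fin u → Fˣ) (c : Fin u → constField σ),
      IsReduction σ x α τ d (lastEntry hu d) ρ ν g c := by
  choose ω g hω hg using h.exists_root_mul_mem_homogeneousGroup hσ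
  obtain ⟨l, hl⟩ : ∃ l : Fin u, l = ⟨u - 1, Nat.sub_one_lt_of_lt hu⟩ := ⟨_, rfl⟩
  have hlast : lastEntry hu d = d l := hl ▸ rfl
  have : NeZero (d l) := ⟨(h.d_pos l).ne'⟩
  have hprim : IsPrimitiveRoot (ω l) (d l) :=
    h.orderOf_eq (g l).ne_zero (hg l) (hω l) ▸ IsPrimitiveRoot.orderOf (ω l)
  have dvd_last (i : Fin u) : d i ∣ d l :=
    h.dvd i l (hl ▸ Fin.le_def.2 (Nat.le_sub_one_of_lt i.2))
  choose ν hνlt hν using fun i =>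
    hprim.eq_pow_of_pow_eq_one (orderOf_dvd_iff_pow_eq_one.1
      ((orderOf_dvd_of_pow_eq_one (hω i)).trans (dvd_last i)))
  have shift_g (i : Fin u) : σ (g i) = (ω l : F) ^ ν i * α (Fin.castAdd s i) * g i := by
    rw [hg, ← hν i, SubmonoidClass.coe_pow]
  choose c hc0 hc using fun i => h.exists_tau_gen_eq (hω l) (hνlt i).le (shift_g i)
  exact ⟨ω l, ν, g, c, hlast ▸ ⟨hω l, hνlt, shift_g, fun i => by rw [hν, hω], hc0, hc⟩⟩

end SpecialCase

/-! ### The kernel of `τ` -/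

namespace IsReduction

/-- The units `cᵢ ḡᵢ` of `F`. -/
def coeff (hR : IsReduction σ x α τ d n ρ ν g c) (i : Fin u) : Fˣ :=
  Units.mk0 (c i : F) (by simpa using hR.c_ne_zero i) * g i

theorem rho_sub_mul (hR : IsReduction σ x α τ d n ρ ν g c) (i : Fin u) :
    ρ ^ (n - ν i) * ρ ^ ν i = 1 := by
  rw [← pow_add, Nat.sub_add_cancel (hR.nu_lt i).le, hR.rho_pow]

theorem rho_sub_pow_eq_one_iff (hR : IsReduction σ x α τ d n ρ ν g c) (i : Fin u) (k : ℕ) :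
    (ρ ^ (n - ν i)) ^ k = 1 ↔ (ρ ^ ν i) ^ k = 1 := by
  have hmul : (ρ ^ (n - ν i)) ^ k * (ρ ^ ν i) ^ k = 1 := by
    rw [← mul_pow, hR.rho_sub_mul, one_pow]
  exact ⟨fun h => by rwa [h, one_mul] at hmul, fun h => by rwa [h, mul_one] at hmul⟩

theorem tau_gen_pow (hR : IsReduction σ x α τ d n ρ ν g c) (i : Fin u) :
    τ (x (Fin.castAdd s i)) ^ d i = τ (algebraMap F H (c i * g i)) ^ d i := by
  rw [hR.tau_gen, mul_pow, ← map_pow (geomSeq (constField σ)),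
    (hR.rho_sub_pow_eq_one_iff i _).2 (hR.rho_nu_pow i), map_one, mul_one]

theorem relIdeal_le_ker (hR : IsReduction σ x α τ d n ρ ν g c) :
    relIdeal x d g c ≤ RingHom.ker τ := by
  refine Ideal.span_le.2 ?_
  rintro _ ⟨i, rfl⟩
  change τ _ = 0
  rw [map_sub, map_pow, map_pow, hR.tau_gen_pow, sub_self]

end IsReduction

/-- The exponent vector obtained by reducing the first `u` exponents modulo `d₁, …, d_u`. -/
def reducedExp (d : Fin u → ℕ) (m : Fin (u + s) → ℤ) : Fin (u + s) → ℤ :=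
  Fin.append (fun i => m (Fin.castAdd s i) % d i) fun j => m (Fin.natAdd u j)

theorem laurentMonomial_eq_mul_reducedExp {y : Fin (u + s) → Hˣ} {w : Fin u → Hˣ}
    (hy : ∀ i, y (Fin.castAdd s i) ^ d i = w i ^ d i) (m : Fin (u + s) → ℤ) :
    laurentMonomial y m = laurentMonomial w (fun i => d i * (m (Fin.castAdd s i) / d i)) *
      laurentMonomial y (reducedExp d m) := by
  rw [reducedExp, laurentMonomial_append, laurentMonomial_eq_castAdd_mul_natAdd y m, ← mul_assoc]
  congr 1
  simp only [laurentMonomial, ← Units.val_mul, ← Finset.prod_mul_distrib]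
  congr 1
  refine Finset.prod_congr rfl fun i _ => ?_
  conv_lhs =>
    rw [← Int.mul_ediv_add_emod (m _) (d i), zpow_add, zpow_mul, zpow_natCast, hy, ← zpow_natCast,
      ← zpow_mul]

theorem IsReduction.span_mk_reducedExp (hR : IsReduction σ x α τ d n ρ ν g c)
    (h : IsPExtension σ σH x α) :
    Submodule.span F (Set.range fun m : Set.range (reducedExp (s := s) d) =>
      Ideal.Quotient.mk (relIdeal x d g c) (laurentMonomial x m)) = ⊤ := by
  let mk := Ideal.Quotient.mk (relIdeal x d g c)
  have mk_surjective : Function.Surjective (Ideal.Quotient.mkₐ F (relIdeal x d g c)).toLinearMap :=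
    Ideal.Quotient.mk_surjective
  rw [eq_top_iff, ← LinearMap.range_eq_top.2 mk_surjective, LinearMap.range_eq_map,
    ← h.span_eq_top, Submodule.map_span, Submodule.span_le]
  rintro _ ⟨_, ⟨m, rfl⟩, rfl⟩
  let mkUnits := Units.map (mk : H →* H ⧸ relIdeal x d g c)
  let coeffUnits := Units.map (algebraMap F H : F →* H)
  have gen_pow (i : Fin u) : mkUnits (x (Fin.castAdd s i)) ^ d i =
      mkUnits (coeffUnits (hR.coeff i)) ^ d i :=
    have hmem : (x (Fin.castAdd s i) : H) ^ d i - algebraMap F H (c i * g i) ^ d i ∈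
        relIdeal x d g c := Ideal.subset_span ⟨i, rfl⟩
    Units.ext (Ideal.Quotient.eq.2 hmem)
  have reduce : mk (laurentMonomial x m) =
      mk (algebraMap F H (laurentMonomial hR.coeff fun i =>
        d i * (m (Fin.castAdd s i) / d i))) * mk (laurentMonomial x (reducedExp d m)) := by
    simp only [map_laurentMonomial]
    exact laurentMonomial_eq_mul_reducedExp gen_pow m
  refine Set.mem_of_eq_of_mem (reduce.trans (Algebra.smul_def (laurentMonomial hR.coeff _) _).symm)
    (Submodule.smul_mem _ _ (Submodule.subset_span ⟨⟨reducedExp d m, m, rfl⟩, rfl⟩))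

theorem SpecialCase.eq_of_reducedExp_sub_mem (h : SpecialCase σ τF σH x α τ d)
    (m m' : Set.range (reducedExp (s := s) d)) (hm : m.1 - m'.1 ∈ relModule σ α) : m = m' := by
  obtain ⟨_, m, rfl⟩ := m
  obtain ⟨_, m', rfl⟩ := m'
  obtain ⟨hdvd, hzero⟩ := h.mem_relModule.1 hm
  simp only [reducedExp, Pi.sub_apply, Fin.append_left, Fin.append_right] at hdvd hzero
  refine Subtype.ext (funext fun l => ?_)
  simp only [reducedExp]
  induction l using Fin.addCases with
  | left i =>
    rw [Fin.append_left, Fin.append_left]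
    simpa using Int.emod_eq_emod_iff_emod_sub_eq_zero.2 (Int.emod_eq_zero_of_dvd (hdvd i))
  | right j => simpa only [Fin.append_right] using sub_eq_zero.1 (hzero j)

theorem SpecialCase.ker_tau_eq_relIdeal (h : SpecialCase σ τF σH x α τ d)
    (hR : IsReduction σ x α τ d n ρ ν g c) : RingHom.ker τ = relIdeal x d g c := by
  refine le_antisymm (fun f hf => ?_) hR.relIdeal_le_ker
  let factor := Ideal.Quotient.factorₐ F hR.relIdeal_le_ker
  have factor_injective : Function.Injective factor :=
    injective_of_linearIndependent_comp factor.toLinearMap (hR.span_mk_reducedExp h.isPExtension)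
      (h.linearIndependent_mk_laurentMonomial h.eq_of_reducedExp_sub_mem)
  rw [← Ideal.Quotient.eq_zero_iff_mem] at hf ⊢
  exact (map_eq_zero_iff factor factor_injective).1 hf

end Reduction

/-! ### The factorization of `τ` -/

theorem exists_ringHom_comp_eq {A B C : Type*} [CommRing A] [CommRing B] [CommRing C] {ι : B →+* C}
    (hι : Function.Injective ι) {τ : A →+* C} (h : ∀ a, τ a ∈ ι.range) :
    ∃ lam : A →+* B, ∀ a, ι (lam a) = τ a :=
  let e := RingEquiv.ofBijective ι.rangeRestrict
    ⟨fun _ _ hb => hι (congrArg Subtype.val hb), ι.rangeRestrict_surjective⟩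
  ⟨(e.symm : ι.range →+* B).comp (τ.codRestrict ι.range h), fun a =>
    congrArg Subtype.val (e.apply_symm_apply ⟨τ a, h a⟩)⟩

section Factorization

variable {F : Type*} [Field F] {H : Type*} [CommRing H] [Algebra F H] {u s : ℕ}
  {σ : F ≃+* F} {τF : F →+* SeqRing (constField σ)} {σH : H ≃+* H}
  {x : Fin (u + s) → Hˣ} {α : Fin (u + s) → Fˣ} {τ : H →+* SeqRing (constField σ)}
  {d : Fin u → ℕ} {n : ℕ} {ρ : constField σ} {ν : Fin u → ℕ} {g : Fin u → Fˣ}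
  {c : Fin u → constField σ} {σE : tailRing F x ≃+* tailRing F x}

theorem IsReduction.tau_gen_of_one (hR : IsReduction σ x α τ d 1 ρ ν g c) (i : Fin u) :
    τ (x (Fin.castAdd s i)) = tailTau x τ (algebraMap F (tailRing F x) (c i * g i)) := by
  have hρ : ρ = 1 := by simpa using hR.rho_pow
  rw [hR.tau_gen, hρ, one_pow, map_one, mul_one]
  rfl

theorem IsReduction.tau_mem_range_tailTau (hR : IsReduction σ x α τ d 1 ρ ν g c)
    (h : IsPExtension σ σH x α) (f : H) : τ f ∈ (tailTau (F := F) x τ).range := by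
  refine map_mem_of_span_laurentMonomial h.span_eq_top τ (R := (tailTau (F := F) x τ).range)
    (fun a => ⟨algebraMap F (tailRing F x) a, rfl⟩) (fun l => ?_) f
  let map_tailTau := Units.map (tailTau (F := F) x τ : tailRing F x →* SeqRing (constField σ))
  have map_tailTau_mem (y : (tailRing F x)ˣ) :
      map_tailTau y ∈ (tailTau (F := F) x τ).range.toSubmonoid.units :=
    (Submonoid.mem_units_iff _ _).2
      ⟨⟨y, rfl⟩, ⟨(y⁻¹ : (tailRing F x)ˣ), congrArg Units.val (map_inv map_tailTau y)⟩⟩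
  induction l using Fin.addCases with
  | left i =>
    have hgen : Units.map (τ : H →* _) (x (Fin.castAdd s i)) = map_tailTau
        (Units.map (algebraMap F (tailRing F x) : F →* _) (hR.coeff i)) :=
      Units.ext (hR.tau_gen_of_one i)
    exact hgen ▸ map_tailTau_mem _
  | right j => exact map_tailTau_mem (tailGen F x j)

theorem SpecialCase.exists_piFactorization (h : SpecialCase σ τF σH x α τ d)
    (hR : IsReduction σ x α τ d 1 ρ ν g c) (hE : TailStatement σ σH x α τ σE) :
    ∃ lam : H →+* tailRing F x, PiFactorization σ σH x α τ d σE g c lam := by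
  have hinj := hE.isKEmbedding.injective
  obtain ⟨lam, hlam⟩ := exists_ringHom_comp_eq hinj (hR.tau_mem_range_tailTau h.isPExtension)
  have lam_tail (e : tailRing F x) : lam e = e := hinj (hlam e)
  have ker_tau : RingHom.ker τ = RingHom.ker lam := by
    ext f
    rw [RingHom.mem_ker, RingHom.mem_ker, ← hlam, map_eq_zero_iff _ hinj]
  have hν (i : Fin u) : ν i = 0 := Nat.lt_one_iff.1 (hR.nu_lt i)
  exact ⟨lam,
    { shift_g := fun i => by simpa [hν] using hR.shift_g i
      c_ne_zero := hR.c_ne_zero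
      lam_diffHom := fun f => hinj (by
        rw [hlam, h.isKHom.diffHom, hE.isKEmbedding.diffHom, hlam])
      lam_surjective := fun e => ⟨e, lam_tail e⟩
      lam_tail := lam_tail
      lam_gen := fun i => hinj ((hlam _).trans (hR.tau_gen_of_one i))
      tau_lam := hlam
      ker_tau := ker_tau
      ker_lam := ker_tau ▸ h.ker_tau_eq_relIdeal hR }⟩

end Factorization

theorem span_range_pow_eq_top_of_adjoin {R B : Type*} [CommRing R] [CommRing B] [Algebra R B]
    {z : B} {n : ℕ} (hn : 0 < n) (hz : z ^ n = 1) (h : Algebra.adjoin R {z} = ⊤) :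
    Submodule.span R (Set.range fun i : Fin n => z ^ (i : ℕ)) = ⊤ := by
  rw [eq_top_iff, ← Algebra.top_toSubmodule, ← h, Algebra.adjoin_eq_span]
  refine Submodule.span_mono fun y hy => ?_
  obtain ⟨m, rfl⟩ := Submonoid.mem_closure_singleton.1 hy
  exact ⟨⟨m % n, Nat.mod_lt m hn⟩, (pow_eq_pow_mod m hz).symm⟩

theorem linearIndependent_of_linearIndependent_smul {R S M I J : Type*} [CommRing R] [Ring S]
    [Algebra R S] [AddCommGroup M] [Module R M] [Module S M] [IsScalarTower R S M] {b : I → S}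
    {z : J → M} (hb : Submodule.span R (Set.range b) = ⊤)
    (h : LinearIndependent R fun p : J × I => b p.2 • z p.1) : LinearIndependent S z := by
  refine injective_of_linearIndependent_comp ((Finsupp.linearCombination S z).restrictScalars R)
    (v := fun p : J × I => Finsupp.single p.1 (b p.2)) (eq_top_iff.2 fun y _ => ?_) ?_
  · induction y using Finsupp.induction_linear with
    | zero => exact Submodule.zero_mem _
    | add y y' hy hy' => exact Submodule.add_mem _ (hy trivial) (hy' trivial)
    | single j a =>
      have ha : Finsupp.single j a ∈
          (Submodule.span R (Set.range b)).map (Finsupp.lsingle (R := R) j) :=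
        ⟨a, hb ▸ Submodule.mem_top, rfl⟩
      rw [Submodule.map_span, ← Set.range_comp] at ha
      refine Submodule.span_mono (Set.range_subset_iff.2 fun i => ?_) ha
      exact Set.mem_range_self (f := fun p : J × I => Finsupp.single p.1 (b p.2)) (j, i)
  · have hcomp : (Finsupp.linearCombination S z).restrictScalars R ∘
        (fun p : J × I => Finsupp.single p.1 (b p.2)) = fun p => b p.2 • z p.1 :=
      funext fun p => Finsupp.linearCombination_single S (b p.2) p.1
    exact hcomp ▸ h

theorem orderOf_pow_eq_of_kerLift_eq {K A : Type*} [Field K] [CommRing A] {τ : A →+* SeqRing K}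
    {z : A ⧸ RingHom.ker τ} {ρ : K} (hz : RingHom.kerLift τ z = geomSeq K ρ) (m : ℕ) :
    orderOf (z ^ m) = orderOf (ρ ^ m) := by
  rw [← orderOf_injective (RingHom.kerLift τ : _ →* SeqRing K)
      (RingHom.kerLift_injective τ),
    ← orderOf_injective (geomSeq K) geomSeq_injective, map_pow, map_pow]
  exact congrArg (fun y => orderOf (y ^ m)) hz

section RootFactorization

variable {F : Type w} [Field F] {H : Type v} [CommRing H] [Algebra F H] {u s : ℕ}
  {σ : F ≃+* F} {τF : F →+* SeqRing (constField σ)} {σH : H ≃+* H}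
  {x : Fin (u + s) → Hˣ} {α : Fin (u + s) → Fˣ} {τ : H →+* SeqRing (constField σ)}
  {d : Fin u → ℕ} {n : ℕ} {ρ : constField σ} {ν : Fin u → ℕ} {g : Fin u → Fˣ}
  {c : Fin u → constField σ} {σE : tailRing F x ≃+* tailRing F x} {z : H ⧸ RingHom.ker τ}

namespace IsReduction

theorem mk_gen (hR : IsReduction σ x α τ d n ρ ν g c) (hz : RingHom.kerLift τ z = geomSeq _ ρ)
    (i : Fin u) :
    Ideal.Quotient.mk (RingHom.ker τ) (x (Fin.castAdd s i)) =
      algebraMap (tailRing F x) _ (algebraMap F (tailRing F x) (c i * g i)) * z ^ (n - ν i) := by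
  refine RingHom.kerLift_injective τ ?_
  rw [map_mul, map_pow, hz, ← map_pow]
  exact hR.tau_gen i

theorem pow_eq_one (hR : IsReduction σ x α τ d n ρ ν g c)
    (hz : RingHom.kerLift τ z = geomSeq _ ρ) : z ^ n = 1 :=
  RingHom.kerLift_injective τ (by rw [map_pow, hz, ← map_pow, hR.rho_pow, map_one, map_one])

theorem adjoin_eq_top (hR : IsReduction σ x α τ d n ρ ν g c) (h : IsPExtension σ σH x α)
    (hn : n ≠ 0) (hz : RingHom.kerLift τ z = geomSeq _ ρ) :
    Algebra.adjoin (tailRing F x) {z} = ⊤ := by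
  let mk := Ideal.Quotient.mk (RingHom.ker τ)
  let R := Algebra.adjoin (tailRing F x) {z}
  let ofTail := Units.map (algebraMap (tailRing F x) (H ⧸ RingHom.ker τ)).toMonoidHom
  have ofTail_mem (e : (tailRing F x)ˣ) : ofTail e ∈ R.toSubring.toSubmonoid.units :=
    (Submonoid.mem_units_iff _ _).2 ⟨Subalgebra.algebraMap_mem R e,
      Subalgebra.algebraMap_mem R (e⁻¹ : (tailRing F x)ˣ)⟩
  refine eq_top_iff.2 fun b _ => ?_
  obtain ⟨f, rfl⟩ := Ideal.Quotient.mk_surjective b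
  refine map_mem_of_span_laurentMonomial h.span_eq_top mk (R := R.toSubring)
    (fun a => Subalgebra.algebraMap_mem R (algebraMap F (tailRing F x) a)) (fun j => ?_) f
  induction j using Fin.addCases with
  | left i =>
    let zUnit := Units.ofPowEqOne z n (hR.pow_eq_one hz) hn
    have z_mem : z ∈ R := Algebra.self_mem_adjoin_singleton _ z
    have zUnit_inv : ((zUnit⁻¹ : (H ⧸ RingHom.ker τ)ˣ) : H ⧸ RingHom.ker τ) = z ^ (n - 1) :=
      mul_one _
    have zUnit_mem : zUnit ∈ R.toSubring.toSubmonoid.units :=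
      (Submonoid.mem_units_iff _ _).2 ⟨z_mem, zUnit_inv ▸ R.pow_mem z_mem (n - 1)⟩
    have mk_gen_units : Units.map (mk : H →* _) (x (Fin.castAdd s i)) =
        ofTail (Units.map (algebraMap F (tailRing F x) : F →* _) (hR.coeff i)) *
          zUnit ^ (n - ν i) := Units.ext (hR.mk_gen hz i)
    exact mk_gen_units ▸ Subgroup.mul_mem _ (ofTail_mem _) (Subgroup.pow_mem _ zUnit_mem _)
  | right j => exact ofTail_mem (tailGen F x j)

end IsReduction

namespace SpecialCase

theorem orderOf_rho_nu (h : SpecialCase σ τF σH x α τ d)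
    (hR : IsReduction σ x α τ d n ρ ν g c) (i : Fin u) : orderOf (ρ ^ ν i) = d i :=
  h.orderOf_eq (g i).ne_zero (by rw [hR.shift_g, SubmonoidClass.coe_pow]) (hR.rho_nu_pow i)

theorem orderOf_rho_sub (h : SpecialCase σ τF σH x α τ d)
    (hR : IsReduction σ x α τ d n ρ ν g c) (i : Fin u) : orderOf (ρ ^ (n - ν i)) = d i := by
  rw [← h.orderOf_rho_nu hR i, orderOf_eq_orderOf_iff]
  exact hR.rho_sub_pow_eq_one_iff i

theorem orderOf_rho (h : SpecialCase σ τF σH x α τ d)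
    (hR : IsReduction σ x α τ d n ρ ν g c) {l : Fin u} (hl : d l = n) : orderOf ρ = n := by
  refine Nat.dvd_antisymm (orderOf_dvd_of_pow_eq_one hR.rho_pow) ?_
  rw [← hl, ← h.orderOf_rho_nu hR l]
  exact orderOf_pow_dvd _

theorem exists_geomSeq_preimage (h : SpecialCase σ τF σH x α τ d)
    (hR : IsReduction σ x α τ d n ρ ν g c) {l : Fin u} (hl : d l = n) :
    ∃ (w : Fˣ) (k : ℕ), (ρ ^ (n - ν l)) ^ k = ρ ∧
      τ (algebraMap F H w * (x (Fin.castAdd s l) : H) ^ k) = geomSeq _ ρ := by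
  have hprim := IsPrimitiveRoot.orderOf (ρ ^ (n - ν l))
  rw [h.orderOf_rho_sub hR, hl] at hprim
  have : NeZero n := ⟨hl ▸ (h.d_pos l).ne'⟩
  obtain ⟨k, -, hk⟩ := hprim.eq_pow_of_pow_eq_one hR.rho_pow
  refine ⟨(hR.coeff l)⁻¹ ^ k, k, hk, ?_⟩
  have cancel : ((hR.coeff l)⁻¹ : Fˣ) * ((c l : F) * g l) = 1 := (hR.coeff l).inv_mul
  rw [Units.val_pow_eq_pow_val, map_pow, ← mul_pow, map_pow, map_mul, hR.tau_gen, ← mul_assoc,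
    ← map_mul, ← map_mul, cancel, map_one, map_one, one_mul, ← map_pow, hk]

theorem eq_of_append_single_sub_mem (h : SpecialCase σ τF σH x α τ d)
    (hR : IsReduction σ x α τ d n ρ ν g c) {l : Fin u} (hl : d l = n) {k : ℕ}
    (hk : (ρ ^ (n - ν l)) ^ k = ρ) {p q : Fin n × (Fin s → ℤ)}
    (hpq : (Fin.append (Pi.single l ((k * p.1 : ℕ) : ℤ)) p.2 -
      Fin.append (Pi.single l ((k * q.1 : ℕ) : ℤ)) q.2) ∈ relModule σ α) : p = q := by
  obtain ⟨hdvd, hzero⟩ := h.mem_relModule.1 hpq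
  refine Prod.ext (Fin.ext ?_) (funext fun j => ?_)
  · have hmod := hdvd l
    simp only [Pi.sub_apply, Fin.append_left, Pi.single_eq_same] at hmod
    rw [← h.orderOf_rho_sub hR l, ← Nat.modEq_iff_dvd] at hmod
    have pow_eq := pow_eq_pow_of_modEq hmod (pow_orderOf_eq_one _)
    rw [pow_mul, pow_mul, hk] at pow_eq
    have hprim := IsPrimitiveRoot.orderOf ρ
    rw [h.orderOf_rho hR hl] at hprim
    exact (hprim.pow_inj q.1.2 p.1.2 pow_eq).symm
  · simpa only [Pi.sub_apply, Fin.append_right, sub_eq_zero] using hzero j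

theorem linearIndependent_pow (h : SpecialCase σ τF σH x α τ d)
    (hR : IsReduction σ x α τ d n ρ ν g c) {l : Fin u} (hl : d l = n)
    (hz : RingHom.kerLift τ z = geomSeq _ ρ) :
    LinearIndependent (tailRing F x) fun i : Fin n => z ^ (i : ℕ) := by
  obtain ⟨w, k, hk, hw⟩ := h.exists_geomSeq_preimage hR hl
  let mk := Ideal.Quotient.mk (RingHom.ker τ)
  obtain rfl : z = mk (algebraMap F H w * (x (Fin.castAdd s l) : H) ^ k) :=
    RingHom.kerLift_injective τ (hz.trans hw.symm)
  let e (p : Fin n × (Fin s → ℤ)) : Fin (u + s) → ℤ :=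
    Fin.append (Pi.single l ((k * p.1 : ℕ) : ℤ)) p.2
  have hind : LinearIndependent F fun p => mk (laurentMonomial x (e p)) :=
    h.linearIndependent_mk_laurentMonomial fun _ _ => h.eq_of_append_single_sub_mem hR hl hk
  have smul_eq (p : Fin n × (Fin s → ℤ)) : (laurentMonomial (tailGen F x) p.2 : tailRing F x) •
      mk (algebraMap F H w * (x (Fin.castAdd s l) : H) ^ k) ^ (p.1 : ℕ) =
        w ^ (p.1 : ℕ) • mk (laurentMonomial x (e p)) := by
    rw [Algebra.smul_def, Units.smul_def, Algebra.smul_def, ← map_pow]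
    change mk ((laurentMonomial (tailGen F x) p.2 : tailRing F x) : H) * mk _ =
      mk (algebraMap F H _) * mk _
    rw [← map_mul, ← map_mul, coe_laurentMonomial_tailGen, laurentMonomial_append,
      laurentMonomial_append, laurentMonomial_zero, laurentMonomial_single, zpow_natCast, one_mul,
      Units.val_pow_eq_pow_val, Units.val_pow_eq_pow_val, mul_pow, ← pow_mul, map_pow]
    congr 1
    ring
  refine linearIndependent_of_linearIndependent_smul (span_laurentMonomial_tailGen (F := F) x) ?_
  simp only [smul_eq]
  exact hind.units_smul fun p => w ^ (p.1 : ℕ)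

theorem isKEmbedding_kerLift (h : SpecialCase σ τF σH x α τ d) :
    IsKEmbedding h.isKHom.diffHom.kerAut
      ((algebraMap (tailRing F x) (H ⧸ RingHom.ker τ)).comp (constIncl σ (tailRing F x)))
      (RingHom.kerLift τ) where
  diffHom := h.isKHom.diffHom.kerLift
  const := h.tau_const
  injective := RingHom.kerLift_injective τ

theorem isRExtension (h : SpecialCase σ τF σH x α τ d)
    (hR : IsReduction σ x α τ d n ρ ν g c) {l : Fin u} (hl : d l = n) (hn : 1 < n)
    (hE : TailStatement σ σH x α τ σE) (hz : RingHom.kerLift τ z = geomSeq _ ρ) :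
    IsRExtension σE h.isKHom.diffHom.kerAut z n (constIncl σ (tailRing F x) ρ) where
  one_lt := hn
  extends_aut e := congrArg (Ideal.Quotient.mk _) (hE.restrict_aut e).symm
  pow_eq_one := hR.pow_eq_one hz
  linearIndependent := h.linearIndependent_pow hR hl hz
  span_eq_top := span_range_pow_eq_top_of_adjoin (one_pos.trans hn) (hR.pow_eq_one hz)
    (hR.adjoin_eq_top h.isPExtension (one_pos.trans hn).ne' hz)
  root_pow := by rw [← map_pow, hR.rho_pow, map_one]
  shift_gen := RingHom.kerLift_injective τ (by
    rw [h.isKHom.diffHom.kerLift, map_mul (RingHom.kerLift τ), hz, seqShift_geomSeq]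
    exact congrArg (· * _) (h.isKEmbedding_kerLift.const ρ).symm)
  noNewConstants b hb := by
    obtain ⟨a, ha⟩ := h.isKEmbedding_kerLift.exists_incl_eq hb
    exact ⟨constIncl σ (tailRing F x) a,
      (hE.isPiExtension.extends_aut _).trans (congrArg _ a.2), ha⟩

theorem exists_rFactorization (h : SpecialCase σ τF σH x α τ d)
    (hR : IsReduction σ x α τ d n ρ ν g c) {l : Fin u} (hl : d l = n) (hn : 1 < n)
    (hE : TailStatement σ σH x α τ σE) :
    ∃ (B : Type v) (_ : CommRing B) (_ : Algebra (tailRing F x) B) (σB : B ≃+* B) (z : B)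
      (τ' : B →+* SeqRing (constField σ)) (lam : H →+* B),
      RFactorization σ σH x α τ d n σE ρ ν g c σB z τ' lam := by
  obtain ⟨w, k, -, hw⟩ := h.exists_geomSeq_preimage hR hl
  obtain ⟨z, hz⟩ : ∃ z, RingHom.kerLift τ z = geomSeq _ ρ := ⟨Ideal.Quotient.mk _ _, hw⟩
  refine ⟨H ⧸ RingHom.ker τ, inferInstance, inferInstance, h.isKHom.diffHom.kerAut, z,
    RingHom.kerLift τ, Ideal.Quotient.mk _,
    { isRExtension := h.isRExtension hR hl hn hE hz
      tau'_isKEmbedding := h.isKEmbedding_kerLift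
      tau'_tail := fun e => rfl
      tau'_z := hz
      nu_lt := hR.nu_lt
      shift_g := hR.shift_g
      order_z := fun i => by
        rw [orderOf_pow_eq_of_kerLift_eq hz, orderOf_pow_eq_of_kerLift_eq hz]
        exact ⟨h.orderOf_rho_nu hR i, h.orderOf_rho_sub hR i⟩
      order_rho := fun i => ⟨h.orderOf_rho_nu hR i, h.orderOf_rho_sub hR i⟩
      c_ne_zero := hR.c_ne_zero
      lam_diffHom := fun f => rfl
      lam_surjective := Ideal.Quotient.mk_surjective
      lam_tail := fun e => rfl
      lam_gen := fun i => by
        rw [hR.mk_gen hz, map_mul, map_mul, mul_right_comm]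
      tau_lam := fun f => rfl
      ker_tau := Ideal.mk_ker.symm
      ker_lam := Ideal.mk_ker.trans (h.ker_tau_eq_relIdeal hR) }⟩

end SpecialCase

end RootFactorization

/-! ### Computability of the factorization maps -/

section ComputableFactorization

theorem pow_sub_zpow_eq_pow {G : Type*} [Group G] {z : G} {n e : ℕ} (hz : z ^ n = 1) (he : e ≤ n)
    (m : ℤ) : (z ^ (n - e)) ^ m = z ^ ((n - e) * m.toNat + e * (-m).toNat) := by
  have inv_eq : (z ^ (n - e))⁻¹ = z ^ e := by
    rw [inv_eq_iff_mul_eq_one, ← pow_add, Nat.sub_add_cancel he, hz]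
  rcases m with m | m
  · simp [pow_mul]
  · rw [zpow_negSucc, ← inv_pow, inv_eq, ← pow_mul]
    simp

/-- The exponent of `z` in `∏ᵢ (z ^ (n - νᵢ)) ^ mᵢ`, where `z ^ n = 1`, as a natural number. -/
def rootExponent {u : ℕ} (n : ℕ) (ν : Fin u → ℕ) (m : Fin u → ℤ) : ℕ :=
  ∑ i, ((n - ν i) * (m i).toNat + ν i * (-m i).toNat)

theorem laurentMonomial_pow_sub {B : Type*} [CommRing B] {u n : ℕ} {z : Bˣ} (hz : z ^ n = 1)
    {ν : Fin u → ℕ} (hν : ∀ i, ν i ≤ n) (m : Fin u → ℤ) :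
    laurentMonomial (fun i => z ^ (n - ν i)) m = z ^ rootExponent n ν m := by
  simp only [laurentMonomial, pow_sub_zpow_eq_pow hz (hν _), Finset.prod_pow_eq_pow_sum,
    rootExponent, Units.val_pow_eq_pow_val]

theorem computable_rootExponent {u : ℕ} (n : ℕ) (ν : Fin u → ℕ) : Computable (rootExponent n ν) :=
  computable_finset_sum Primrec.nat_add.to_comp _ fun i =>
    (Primrec.nat_add.comp
      (Primrec.nat_mul.comp (Primrec.const _) (primrec_int_toNat.comp (primrec_fin_eval i)))
      (Primrec.nat_mul.comp (Primrec.const _)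
        (primrec_int_toNat_neg.comp (primrec_fin_eval i)))).to_comp

variable {F : Type w} [Field F] {H : Type v} [CommRing H] [Algebra F H] {u s : ℕ}
  {x : Fin (u + s) → Hˣ}

theorem map_laurentMonomial_of_map_gen {B : Type*} [CommRing B] [Algebra (tailRing F x) B]
    {lam : H →+* B} (tail : ∀ e : tailRing F x, lam e = algebraMap (tailRing F x) B e)
    {G : Fin u → Fˣ} {y : Fin u → Bˣ}
    (gen : ∀ i, lam (x (Fin.castAdd s i)) =
      algebraMap (tailRing F x) B (algebraMap F (tailRing F x) (G i)) * y i)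
    (m : Fin (u + s) → ℤ) :
    lam (laurentMonomial x m) = algebraMap (tailRing F x) B
        (algebraMap F (tailRing F x) (laurentMonomial G fun i => m (Fin.castAdd s i)) *
          laurentMonomial (tailGen F x) fun j => m (Fin.natAdd u j)) *
      laurentMonomial y fun i => m (Fin.castAdd s i) := by
  let ι := (algebraMap (tailRing F x) B).comp (algebraMap F (tailRing F x))
  have map_head : (fun i => Units.map (lam : H →* B) (x (Fin.castAdd s i))) =
      fun i => Units.map (ι : F →* B) (G i) * y i := funext fun i => Units.ext (gen i)
  have map_tail : (fun j => Units.map (lam : H →* B) (x (Fin.natAdd u j))) =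
      fun j => Units.map (algebraMap (tailRing F x) B : _ →* B) (tailGen F x j) :=
    funext fun j => Units.ext (tail (tailGen F x j))
  rw [laurentMonomial_eq_castAdd_mul_natAdd, map_mul, map_laurentMonomial lam,
    map_laurentMonomial lam, map_head, map_tail, laurentMonomial_mul, ← map_laurentMonomial ι,
    ← map_laurentMonomial (algebraMap (tailRing F x) B), map_mul, mul_right_comm]
  rfl

variable [Primcodable F] {σ : F ≃+* F} {σH : H ≃+* H} {α : Fin (u + s) → Fˣ}
  {τ : H →+* SeqRing (constField σ)} {d : Fin u → ℕ} {g : Fin u → Fˣ} {c : Fin u → constField σ}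
  {σE : tailRing F x ≃+* tailRing F x}

theorem PiFactorization.computableVia {lam : H →+* tailRing F x}
    (h : PiFactorization σ σH x α τ d σE g c lam) (hmul : Computable₂ fun a b : F => a * b) :
    ComputableVia (laurentRep (F := F) x) (laurentRep (F := F) (tailGen F x)) lam := by
  let G (i : Fin u) : Fˣ := Units.mk0 (c i : F) (by simpa using h.c_ne_zero i) * g i
  have gen (i : Fin u) : lam (x (Fin.castAdd s i)) =
      algebraMap F (tailRing F x) (G i) * (1 : Fin u → (tailRing F x)ˣ) i :=
    (h.lam_gen i).trans (mul_one _).symm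
  refine computableVia_termRep hmul Computable.id lam (fun a => h.lam_tail (algebraMap F _ a))
    (χ := fun m => laurentMonomial G fun i => m (Fin.castAdd s i))
    ((computable_laurentMonomial hmul G).comp (primrec_fin_comp _).to_comp)
    (p := fun m j => m (Fin.natAdd u j)) (primrec_fin_comp _).to_comp fun m => ?_
  simpa [laurentMonomial] using map_laurentMonomial_of_map_gen h.lam_tail gen m

theorem RFactorization.computableVia {n : ℕ} {ρ : constField σ} {ν : Fin u → ℕ} {B : Type*}
    [CommRing B] [Algebra (tailRing F x) B] {σB : B ≃+* B} {z : B}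
    {τ' : B →+* SeqRing (constField σ)} {lam : H →+* B}
    (h : RFactorization σ σH x α τ d n σE ρ ν g c σB z τ' lam)
    (hmul : Computable₂ fun a b : F => a * b) :
    ComputableVia (laurentRep (F := F) x) (laurentRootRep (F := F) (tailGen F x) z) lam := by
  let G (i : Fin u) : Fˣ := Units.mk0 (c i : F) (by simpa using h.c_ne_zero i) * g i
  let zUnit : Bˣ := Units.ofPowEqOne z n h.isRExtension.pow_eq_one
    (one_pos.trans h.isRExtension.one_lt).ne'
  have gen (i : Fin u) : lam (x (Fin.castAdd s i)) =
      algebraMap _ B (algebraMap F (tailRing F x) (G i)) * (zUnit ^ (n - ν i) : Bˣ) := by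
    simp [h.lam_gen, G, zUnit, mul_right_comm]
  rw [laurentRootRep_eq_termRep]
  refine computableVia_termRep hmul Computable.id lam (fun a => h.lam_tail (algebraMap F _ a))
    (χ := fun m => laurentMonomial G fun i => m (Fin.castAdd s i))
    ((computable_laurentMonomial hmul G).comp (primrec_fin_comp _).to_comp)
    (p := fun m => (fun j => m (Fin.natAdd u j), rootExponent n ν fun i => m (Fin.castAdd s i)))
    ((primrec_fin_comp _).to_comp.pair
      ((computable_rootExponent n ν).comp (primrec_fin_comp _).to_comp)) fun m => ?_
  rw [map_laurentMonomial_of_map_gen h.lam_tail gen,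
    laurentMonomial_pow_sub (Units.pow_ofPowEqOne _ _) fun i => (h.nu_lt i).le, map_mul, mul_assoc]
  rfl

end ComputableFactorization

/-! ### Certificates -/

section Evaluation

variable {F : Type*} [Field F] {σ : F ≃+* F} {ev : F → ℕ → constField σ} {L : F → ℕ}

theorem IsOSigmaFunction.ev_aut (hL : IsOSigmaFunction σ ev L) {f : F} {k : ℕ} (hk : L f ≤ k) :
    ev (σ f) k = ev f (k + 1) := by
  simpa using hL.shift f 1 k (by simpa using hk)

theorem IsOSigmaFunction.ev_const (hL : IsOSigmaFunction σ ev L) (hev : IsEvaluation σ ev)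
    (c : constField σ) {k : ℕ} (hk : L c ≤ k) : ev c k = c := by
  have aut_c : σ c = c := c.2
  have ev_add (j : ℕ) : ev c (k + j) = ev c k := by
    induction j with
    | zero => rfl
    | succ j ih => rw [← ih, ← add_assoc, ← hL.ev_aut (hk.trans (Nat.le_add_right k j)), aut_c]
  obtain ⟨N, hN⟩ := eventually_atTop.1 (hev.const c)
  rw [← ev_add N]
  exact hN _ (Nat.le_add_left N k)

/-- The certificate for elements `ρ, g, e, c` to describe a generator `x` with `σ(x) = a x` and
`τ(x) = (κ ∏_{l ≤ k < m} ev(a, k))_m` as in (2a) and (2b): besides the algebraic conditions,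
`τ(x)` and `c g (ρ^(n-e))^m` are compared at the single point `m = N`. -/
structure CandidateCheck (σ : F ≃+* F) (ev : F → ℕ → constField σ) (L : F → ℕ) (N n : ℕ) (ρ : F)
    (a κ : F) (l d : ℕ) (g : F) (e : ℕ) (c : F) : Prop where
  c_const : σ c = c
  c_ne_zero : c ≠ 0
  g_ne_zero : g ≠ 0
  lt : e < n
  shift_g : σ g = ρ ^ e * a * g
  pow_eq_one : (ρ ^ e) ^ d = 1
  start_le : l ≤ N
  bound_le : ∀ f ∈ [g, ρ ^ e * a, ρ ^ e, a], L f ≤ N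
  eval_eq : κ * ∏ k ∈ Finset.Ico l N, (ev a k : F) = c * ev g N * (ρ ^ (n - e)) ^ N

theorem ev_succ_mul_pow_succ (hL : IsOSigmaFunction σ ev L) (hev : IsEvaluation σ ev) {n e N : ℕ}
    (he : e ≤ n) {ρ : constField σ} (hρ : ρ ^ n = 1) {a g : F} (hg : σ g = (ρ : F) ^ e * a * g)
    (hN : ∀ f ∈ [g, (ρ : F) ^ e * a, (ρ : F) ^ e, a], L f ≤ N) :
    ev g (N + 1) * (ρ ^ (n - e)) ^ (N + 1) = ev g N * (ρ ^ (n - e)) ^ N * ev a N := by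
  simp only [List.forall_mem_cons] at hN
  obtain ⟨g_le, mul_le, pow_le, a_le, -⟩ := hN
  have ev_pow : ev ((ρ : F) ^ e) N = ρ ^ e := by
    simpa using hL.ev_const hev (ρ ^ e) (k := N) (by simpa using pow_le)
  have pow_mul_pow : ρ ^ e * ρ ^ (n - e) = 1 := by rw [← pow_add, Nat.add_sub_cancel' he, hρ]
  rw [← hL.ev_aut g_le, hg, hL.mul _ _ _ (max_le mul_le g_le), hL.mul _ _ _ (max_le pow_le a_le),
    ev_pow, pow_succ]
  linear_combination ev a N * ev g N * (ρ ^ (n - e)) ^ N * pow_mul_pow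

theorem CandidateCheck.toSeq_eq (hL : IsOSigmaFunction σ ev L) (hev : IsEvaluation σ ev)
    {N n l d e : ℕ} {ρ κ c : constField σ} {a g : F} (hρ : ρ ^ n = 1)
    (h : CandidateCheck σ ev L N n ρ a κ l d g e c) :
    (toSeq fun m => κ * ∏ k ∈ Finset.Ico l m, ev a k) =
      toSeq fun m => c * ev g m * (ρ ^ (n - e)) ^ m := by
  refine Germ.coe_eq.2 (eventually_atTop.2 ⟨N, fun m hm => ?_⟩)
  induction m, hm using Nat.le_induction with
  | base => exact Subtype.ext (by simpa using h.eval_eq)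
  | succ m hm ih =>
    beta_reduce at ih ⊢
    rw [Finset.prod_Ico_succ_top (h.start_le.trans hm), ← mul_assoc, ih]
    linear_combination (-c) * ev_succ_mul_pow_succ hL hev h.lt.le hρ h.shift_g
      fun f hf => (h.bound_le f hf).trans hm

theorem computablePred_candidateCheck [Primcodable F] (hF : IsComputableDiffField σ)
    (hev : Computable₂ fun (f : F) (n : ℕ) => (ev f n : F)) (hL : Computable L) {A : Type*}
    [Primcodable A] {N n l d e : A → ℕ} {ρ a κ g c : A → F} (hN : Computable N)
    (hn : Computable n) (hl : Computable l) (hd : Computable d) (he : Computable e)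
    (hρ : Computable ρ) (ha : Computable a) (hκ : Computable κ) (hg : Computable g)
    (hc : Computable c) :
    ComputablePred fun q =>
      CandidateCheck σ ev L (N q) (n q) (ρ q) (a q) (κ q) (l q) (d q) (g q) (e q) (c q) := by
  have pow : Computable fun q => ρ q ^ e q := computable_pow hF.mul hρ he
  have pow_mul : Computable fun q => ρ q ^ e q * a q := hF.mul.comp pow ha
  have bounded : Computable fun q => [g q, ρ q ^ e q * a q, ρ q ^ e q, a q] :=
    Computable.list_cons.comp hg (Computable.list_cons.comp pow_mul
      (Computable.list_cons.comp pow (Computable.list_cons.comp ha (Computable.const []))))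
  have prod : Computable fun q => ∏ k ∈ Finset.Ico (l q) (N q), (ev (a q) k : F) :=
    (computable_prod_range (f := fun q k => (ev (a q) (l q + k) : F)) hF.mul
      (Primrec.nat_sub.to_comp.comp hN hl) (hev.comp (ha.comp .fst)
        (Primrec.nat_add.to_comp.comp (hl.comp .fst) .snd))).of_eq fun q =>
      (Finset.prod_Ico_eq_prod_range (fun k => (ev (a q) k : F)) _ _).symm
  have rhs : Computable fun q => c q * ev (g q) (N q) * (ρ q ^ (n q - e q)) ^ N q :=
    hF.mul.comp (hF.mul.comp hc (hev.comp hg hN)) (computable_pow hF.mul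
      (computable_pow hF.mul hρ (Primrec.nat_sub.to_comp.comp hn he)) hN)
  refine (computablePred_and (computablePred_eq (hF.aut.comp hc) hc) <|
    computablePred_and (computablePred_ne hc (Computable.const 0)) <|
    computablePred_and (computablePred_ne hg (Computable.const 0)) <|
    computablePred_and (computablePred_lt he hn) <|
    computablePred_and (computablePred_eq (hF.aut.comp hg) (hF.mul.comp pow_mul hg)) <|
    computablePred_and (computablePred_eq (computable_pow hF.mul pow hd) (Computable.const 1)) <|
    computablePred_and (computablePred_le hl hN) <|
    computablePred_and (computablePred_forall_mem_list (p := fun q f => L f ≤ N q) bounded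
      (computablePred_le (hL.comp .snd) (hN.comp .fst))) <|
    computablePred_eq (hF.mul.comp hκ prod) rhs).of_eq fun q => ?_
  exact ⟨fun ⟨h1, h2, h3, h4, h5, h6, h7, h8, h9⟩ => ⟨h1, h2, h3, h4, h5, h6, h7, h8, h9⟩,
    fun ⟨h1, h2, h3, h4, h5, h6, h7, h8, h9⟩ => ⟨h1, h2, h3, h4, h5, h6, h7, h8, h9⟩⟩

end Evaluation

section Algorithm

variable {F : Type*} [Field F] {σ : F ≃+* F} {ev : F → ℕ → constField σ} {L : F → ℕ}

/-- The certificate for an output `ρ`, `t = [(ḡᵢ, νᵢ, cᵢ)]` of the algorithm on the input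
`s = [(αᵢ, κᵢ, lᵢ)]`, `d = [dᵢ]`. All indices below are in range when `s` is at least as long as
`d`, so that the default values do not matter. -/
structure OutputCheck (σ : F ≃+* F) (ev : F → ℕ → constField σ) (L : F → ℕ)
    (s : List (F × F × ℕ)) (d : List ℕ) (N : ℕ) (ρ : F) (t : List (F × ℕ × F)) : Prop where
  length_eq : t.length = d.length
  rho_const : σ ρ = ρ
  rho_pow : ρ ^ d.getD (d.length - 1) 0 = 1
  candidate : ∀ i < d.length, CandidateCheck σ ev L N (d.getD (d.length - 1) 0) ρ
    (s.getD i (0, 0, 0)).1 (s.getD i (0, 0, 0)).2.1 (s.getD i (0, 0, 0)).2.2 (d.getD i 0)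
    (t.getD i (0, 0, 0)).1 (t.getD i (0, 0, 0)).2.1 (t.getD i (0, 0, 0)).2.2

theorem computablePred_outputCheck [Primcodable F] (hF : IsComputableDiffField σ)
    (hev : Computable₂ fun (f : F) (n : ℕ) => (ev f n : F)) (hL : Computable L) {A : Type*}
    [Primcodable A] {s : A → List (F × F × ℕ)} {d : A → List ℕ} {N : A → ℕ} {ρ : A → F}
    {t : A → List (F × ℕ × F)} (hs : Computable s) (hd : Computable d) (hN : Computable N)
    (hρ : Computable ρ) (ht : Computable t) :
    ComputablePred fun q => OutputCheck σ ev L (s q) (d q) (N q) (ρ q) (t q) := by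
  have length := Computable.list_length.comp hd
  have last : Computable fun q => (d q).getD ((d q).length - 1) 0 :=
    (Primrec.list_getD 0).to_comp.comp hd (Computable.pred.comp length)
  have input : Computable fun p : A × ℕ => (s p.1).getD p.2 (0, 0, 0) :=
    (Primrec.list_getD _).to_comp.comp (hs.comp .fst) .snd
  have order : Computable fun p : A × ℕ => (d p.1).getD p.2 0 :=
    (Primrec.list_getD _).to_comp.comp (hd.comp .fst) .snd
  have output : Computable fun p : A × ℕ => (t p.1).getD p.2 (0, 0, 0) :=
    (Primrec.list_getD _).to_comp.comp (ht.comp .fst) .snd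
  have candidate := computablePred_candidateCheck hF hev hL (hN.comp .fst) (last.comp .fst)
    (Computable.snd.comp (Computable.snd.comp input)) order
    (Computable.fst.comp (Computable.snd.comp output)) (hρ.comp .fst) (Computable.fst.comp input)
    (Computable.fst.comp (Computable.snd.comp input)) (Computable.fst.comp output)
    (Computable.snd.comp (Computable.snd.comp output))
  refine (computablePred_and (computablePred_eq (Computable.list_length.comp ht) length) <|
    computablePred_and (computablePred_eq (hF.aut.comp hρ) hρ) <|
    computablePred_and (computablePred_eq (computable_pow hF.mul hρ last) (Computable.const 1)) <|
    computablePred_forall_lt (p := fun q i => CandidateCheck σ ev L (N q)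
      ((d q).getD ((d q).length - 1) 0) (ρ q) ((s q).getD i (0, 0, 0)).1
      ((s q).getD i (0, 0, 0)).2.1 ((s q).getD i (0, 0, 0)).2.2 ((d q).getD i 0)
      ((t q).getD i (0, 0, 0)).1 ((t q).getD i (0, 0, 0)).2.1 ((t q).getD i (0, 0, 0)).2.2)
      length candidate).of_eq fun q => ?_
  exact ⟨fun ⟨h1, h2, h3, h4⟩ => ⟨h1, h2, h3, h4⟩, fun ⟨h1, h2, h3, h4⟩ => ⟨h1, h2, h3, h4⟩⟩

theorem exists_partrec_outputCheck [Primcodable F] (hF : IsComputableDiffField σ)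
    (hev : Computable₂ fun (f : F) (n : ℕ) => (ev f n : F)) (hL : Computable L) :
    ∃ search : List (F × F × ℕ) × List ℕ →. F × List (F × ℕ × F), Partrec search ∧
      ∀ a, (∃ N ρ t, OutputCheck σ ev L a.1 a.2 N ρ t) →
        ∃ b ∈ search a, ∃ N, OutputCheck σ ev L a.1 a.2 N b.1 b.2 := by
  obtain ⟨f, hf, spec⟩ := exists_partrec_uniformization (β := ℕ × F × List (F × ℕ × F))
    (R := fun a : List (F × F × ℕ) × List ℕ => fun b => OutputCheck σ ev L a.1 a.2 b.1 b.2.1 b.2.2)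
    (computablePred_outputCheck hF hev hL (Computable.fst.comp .fst) (Computable.snd.comp .fst)
      (Computable.fst.comp .snd) (Computable.fst.comp (Computable.snd.comp .snd))
      (Computable.snd.comp (Computable.snd.comp .snd)))
  refine ⟨fun a => (f a).map Prod.snd, hf.map (Computable.snd.comp .snd), ?_⟩
  rintro a ⟨N, ρ, t, h⟩
  obtain ⟨⟨N', b⟩, mem, hb⟩ := spec a ⟨(N, ρ, t), h⟩
  exact ⟨b, Part.mem_map Prod.snd mem, N', hb⟩

variable {u s : ℕ} {d : Fin u → ℕ} {l : Fin (u + s) → ℕ} {N : ℕ}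

theorem getD_ofFn {β : Type*} {k : ℕ} (f : Fin k → β) (b : β) (i : Fin k) :
    (List.ofFn f).getD i b = f i := by
  simp

theorem getD_ofFn_length_sub_one (hu : 0 < u) :
    (List.ofFn d).getD ((List.ofFn d).length - 1) 0 = lastEntry hu d := by
  rw [List.length_ofFn]
  exact getD_ofFn d 0 ⟨u - 1, _⟩

theorem outputCheck_ofFn_iff (hu : 0 < u) {a κ : Fin (u + s) → F} {ρ : F}
    {t : Fin u → F × ℕ × F} :
    OutputCheck σ ev L (List.ofFn fun i => (a i, κ i, l i)) (List.ofFn d) N ρ (List.ofFn t) ↔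
      σ ρ = ρ ∧ ρ ^ lastEntry hu d = 1 ∧ ∀ i : Fin u, CandidateCheck σ ev L N (lastEntry hu d) ρ
        (a (Fin.castAdd s i)) (κ (Fin.castAdd s i)) (l (Fin.castAdd s i)) (d i)
        (t i).1 (t i).2.1 (t i).2.2 := by
  have input (i : Fin u) : (List.ofFn fun i => (a i, κ i, l i)).getD i (0, 0, 0) =
      (a (Fin.castAdd s i), κ (Fin.castAdd s i), l (Fin.castAdd s i)) :=
    getD_ofFn _ _ (Fin.castAdd s i)
  constructor
  · rintro ⟨-, rho_const, rho_pow, candidate⟩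
    rw [getD_ofFn_length_sub_one hu] at rho_pow
    refine ⟨rho_const, rho_pow, fun i => ?_⟩
    simpa only [getD_ofFn_length_sub_one hu, input, getD_ofFn] using
      candidate i (List.length_ofFn ▸ i.2)
  · rintro ⟨rho_const, rho_pow, candidate⟩
    refine ⟨by simp, rho_const, by rwa [getD_ofFn_length_sub_one hu], fun i hi => ?_⟩
    obtain ⟨i, rfl⟩ : ∃ j : Fin u, (j : ℕ) = i := ⟨⟨i, by simpa using hi⟩, rfl⟩
    simpa only [getD_ofFn_length_sub_one hu, input, getD_ofFn] using candidate i

variable {H : Type*} [CommRing H] [Algebra F H] {τF : F →+* SeqRing (constField σ)}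
  {σH : H ≃+* H} {x : Fin (u + s) → Hˣ} {α : Fin (u + s) → Fˣ} {τ : H →+* SeqRing (constField σ)}
  {κ : Fin (u + s) → constField σ}

namespace SpecialCase

theorem tau_const_mul_mul_geomSeq (h : SpecialCase σ τF σH x α τ d)
    (hτ : ∀ f, τF f = toSeq (ev f)) (c b : constField σ) (g : F) :
    τ (algebraMap F H (c * g)) * geomSeq _ b = toSeq fun m => c * ev g m * b ^ m := by
  rw [map_mul, map_mul, h.tau_const, h.restrict, hτ]
  rfl

theorem eventually_candidateCheck (h : SpecialCase σ τF σH x α τ d)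
    (hτ : ∀ f, τF f = toSeq (ev f))
    (hx : ∀ i, τ (x i) = toSeq fun m => κ i * ∏ k ∈ Finset.Ico (l i) m, ev (α i) k) {n : ℕ}
    {ρ : constField σ} {ν : Fin u → ℕ} {g : Fin u → Fˣ} {c : Fin u → constField σ}
    (hR : IsReduction σ x α τ d n ρ ν g c) (i : Fin u) :
    ∀ᶠ N in atTop, CandidateCheck σ ev L N n ρ (α (Fin.castAdd s i)) (κ (Fin.castAdd s i))
      (l (Fin.castAdd s i)) (d i) (g i) (ν i) (c i) := by
  have tau_eq := hR.tau_gen i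
  rw [h.tau_const_mul_mul_geomSeq hτ, hx] at tau_eq
  filter_upwards [Germ.coe_eq.1 tau_eq, eventually_ge_atTop (l (Fin.castAdd s i)),
    (eventually_all_finite (List.finite_toSet _)).2 fun f _ => eventually_ge_atTop (L f)]
    with N eval_eq start_le bound_le
  exact
    { c_const := (c i).2
      c_ne_zero := by simpa using hR.c_ne_zero i
      g_ne_zero := (g i).ne_zero
      lt := hR.nu_lt i
      shift_g := hR.shift_g i
      pow_eq_one := by simpa using congrArg Subtype.val (hR.rho_nu_pow i)
      start_le := start_le
      bound_le := bound_le
      eval_eq := by simpa using congrArg Subtype.val eval_eq }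

theorem exists_outputCheck (h : SpecialCase σ τF σH x α τ d)
    (hτ : ∀ f, τF f = toSeq (ev f)) (hσ : RadicalStable σ) (hu : 0 < u)
    (hx : ∀ i, τ (x i) = toSeq fun m => κ i * ∏ k ∈ Finset.Ico (l i) m, ev (α i) k) :
    ∃ N ρ t, OutputCheck σ ev L (List.ofFn fun i => ((α i : F), (κ i : F), l i)) (List.ofFn d)
      N ρ t := by
  obtain ⟨ρ, ν, g, c, hR⟩ := h.exists_isReduction hσ hu
  obtain ⟨N, hN⟩ :=
    (eventually_all.2 fun i => h.eventually_candidateCheck (L := L) hτ hx hR i).exists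
  exact ⟨N, ρ, List.ofFn fun i => ((g i : F), ν i, (c i : F)), (outputCheck_ofFn_iff hu).2
    ⟨ρ.2, by simpa using congrArg Subtype.val hR.rho_pow, hN⟩⟩

theorem isReduction_of_outputCheck (h : SpecialCase σ τF σH x α τ d)
    (hτ : ∀ f, τF f = toSeq (ev f)) (hL : IsOSigmaFunction σ ev L) (hev : IsEvaluation σ ev)
    (hu : 0 < u)
    (hx : ∀ i, τ (x i) = toSeq fun m => κ i * ∏ k ∈ Finset.Ico (l i) m, ev (α i) k)
    {ρ : F} {t : List (F × ℕ × F)}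
    (hout : OutputCheck σ ev L (List.ofFn fun i => ((α i : F), (κ i : F), l i)) (List.ofFn d)
      N ρ t) :
    ∃ (ρ' : constField σ) (ν : Fin u → ℕ) (g : Fin u → Fˣ) (c : Fin u → constField σ),
      ((ρ' : F), List.ofFn fun i => ((g i : F), ν i, (c i : F))) = (ρ, t) ∧
        IsReduction σ x α τ d (lastEntry hu d) ρ' ν g c := by
  obtain ⟨t, rfl⟩ : ∃ t' : Fin u → F × ℕ × F, List.ofFn t' = t := by
    have length_eq : t.length = u := hout.length_eq.trans List.length_ofFn
    subst length_eq
    exact ⟨t.get, List.ofFn_get t⟩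
  obtain ⟨rho_const, rho_pow, candidate⟩ := (outputCheck_ofFn_iff hu).1 hout
  lift ρ to constField σ using rho_const
  have rho_pow : ρ ^ lastEntry hu d = 1 := Subtype.ext (by simpa using rho_pow)
  refine ⟨ρ, fun i => (t i).2.1, fun i => Units.mk0 _ (candidate i).g_ne_zero,
    fun i => ⟨_, (candidate i).c_const⟩, rfl, rho_pow, fun i => (candidate i).lt,
    fun i => (candidate i).shift_g, fun i => Subtype.ext (candidate i).pow_eq_one,
    fun i hc => (candidate i).c_ne_zero (congrArg Subtype.val hc), fun i => ?_⟩
  rw [h.tau_const_mul_mul_geomSeq hτ, hx]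
  exact CandidateCheck.toSeq_eq hL hev rho_pow (candidate i)

end SpecialCase

end Algorithm

namespace SpecialCase

variable {F : Type w} [Field F] {H : Type v} [CommRing H] [Algebra F H] {u s : ℕ} {σ : F ≃+* F}
  {τF : F →+* SeqRing (constField σ)} {σH : H ≃+* H} {x : Fin (u + s) → Hˣ}
  {α : Fin (u + s) → Fˣ} {τ : H →+* SeqRing (constField σ)} {d : Fin u → ℕ}

theorem exists_tailStatement (h : SpecialCase σ τF σH x α τ d) :
    ∃ σE : tailRing F x ≃+* tailRing F x, TailStatement σ σH x α τ σE :=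
  h.isPExtension.exists_tail_aut.imp fun _ => h.tailStatement

theorem one_lt_lastEntry (h : SpecialCase σ τF σH x α τ d) {hu : 0 < u}
    (hd : lastEntry hu d ≠ 1) : 1 < lastEntry hu d :=
  (Nat.succ_le_of_lt (h.d_pos _)).lt_of_ne' hd

variable {σE : tailRing F x ≃+* tailRing F x} {n : ℕ} {ρ : constField σ} {ν : Fin u → ℕ}
  {g : Fin u → Fˣ} {c : Fin u → constField σ} [Primcodable F]

theorem exists_computable_piFactorization (h : SpecialCase σ τF σH x α τ d)
    (hR : IsReduction σ x α τ d 1 ρ ν g c) (hE : TailStatement σ σH x α τ σE)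
    (hF : IsComputableDiffField σ) :
    ∃ lam : H →+* tailRing F x, PiFactorization σ σH x α τ d σE g c lam ∧
      ComputableVia (laurentRep (F := F) x) (laurentRep (F := F) (tailGen F x)) lam :=
  (h.exists_piFactorization hR hE).imp fun _ hlam => ⟨hlam, hlam.computableVia hF.mul⟩

theorem exists_computable_rFactorization (h : SpecialCase σ τF σH x α τ d)
    (hR : IsReduction σ x α τ d n ρ ν g c) {i : Fin u} (hi : d i = n) (hn : 1 < n)
    (hE : TailStatement σ σH x α τ σE) (hF : IsComputableDiffField σ) :
    ∃ (B : Type v) (_ : CommRing B) (_ : Algebra (tailRing F x) B) (σB : B ≃+* B) (z : B)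
      (τ' : B →+* SeqRing (constField σ)) (lam : H →+* B),
      RFactorization σ σH x α τ d n σE ρ ν g c σB z τ' lam ∧
      IsComputableDiffRing (laurentRootRep (F := F) (tailGen F x) z) σB ∧
      ComputableVia (laurentRep (F := F) x) (laurentRootRep (F := F) (tailGen F x) z) lam := by
  obtain ⟨B, _, _, σB, z, τ', lam, hB⟩ := h.exists_rFactorization hR hi hn hE
  exact ⟨B, _, _, σB, z, τ', lam, hB, IsAExtension.isComputableDiffRing
    hE.isPiExtension.toIsPExtension hB.isRExtension.toIsAExtension hF, hB.computableVia hF.mul⟩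

end SpecialCase

theorem mainTheorem3_general {F : Type w} [Field F] (σ : F ≃+* F) (hσ : RadicalStable σ)
    (τF : F →+* SeqRing (constField σ)) :
    (∀ (u s : ℕ) (hu : 0 < u) (H : Type v) [CommRing H] [Algebra F H] (σH : H ≃+* H)
      (x : Fin (u + s) → Hˣ) (α : Fin (u + s) → Fˣ) (τ : H →+* SeqRing (constField σ))
      (d : Fin u → ℕ), SpecialCase σ τF σH x α τ d →
      ∃ σE : tailRing F x ≃+* tailRing F x, TailStatement σ σH x α τ σE ∧
        (lastEntry hu d = 1 →
          ∃ (g : Fin u → Fˣ) (c : Fin u → constField σ) (lam : H →+* tailRing F x),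
            PiFactorization σ σH x α τ d σE g c lam) ∧
        (lastEntry hu d ≠ 1 → 1 < lastEntry hu d ∧
          ∃ (ρ : constField σ) (ν : Fin u → ℕ) (g : Fin u → Fˣ) (c : Fin u → constField σ)
            (B : Type v) (_ : CommRing B) (_ : Algebra (tailRing F x) B) (σB : B ≃+* B) (z : B)
            (τ' : B →+* SeqRing (constField σ)) (lam : H →+* B),
            RFactorization σ σH x α τ d (lastEntry hu d) σE ρ ν g c σB z τ' lam)) ∧
    (∀ [Primcodable F] (ev : F → ℕ → constField σ) (L : F → ℕ),
      IsComputableDiffField σ → IsEvaluation σ ev → IsOSigmaFunction σ ev L →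
      (Computable₂ fun (f : F) (n : ℕ) => (ev f n : F)) → Computable L →
      (∀ f, τF f = toSeq (ev f)) →
      ∃ algo : List (F × F × ℕ) × List ℕ →. F × List (F × ℕ × F), Partrec algo ∧
        ∀ (u s : ℕ) (hu : 0 < u) (H : Type v) [CommRing H] [Algebra F H] (σH : H ≃+* H)
          (x : Fin (u + s) → Hˣ) (α : Fin (u + s) → Fˣ) (τ : H →+* SeqRing (constField σ))
          (d : Fin u → ℕ) (κ : Fin (u + s) → constField σ) (l : Fin (u + s) → ℕ),
          SpecialCase σ τF σH x α τ d →
          (∀ i, τ (x i) = toSeq fun n => κ i * ∏ k ∈ Finset.Ico (l i) n, ev (α i) k) →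
          ∃ (ρ : constField σ) (ν : Fin u → ℕ) (g : Fin u → Fˣ) (c : Fin u → constField σ)
            (σE : tailRing F x ≃+* tailRing F x),
            ((ρ : F), List.ofFn fun i => ((g i : F), ν i, (c i : F))) ∈
              algo (List.ofFn fun i => ((α i : F), (κ i : F), l i), List.ofFn d) ∧
            TailStatement σ σH x α τ σE ∧
            IsComputableDiffRing (laurentRep (F := F) (tailGen F x)) σE ∧
            (lastEntry hu d = 1 → ∃ lam : H →+* tailRing F x,
              PiFactorization σ σH x α τ d σE g c lam ∧
              ComputableVia (laurentRep (F := F) x) (laurentRep (F := F) (tailGen F x)) lam) ∧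
            (lastEntry hu d ≠ 1 → 1 < lastEntry hu d ∧
              ∃ (B : Type v) (_ : CommRing B) (_ : Algebra (tailRing F x) B) (σB : B ≃+* B)
                (z : B) (τ' : B →+* SeqRing (constField σ)) (lam : H →+* B),
                RFactorization σ σH x α τ d (lastEntry hu d) σE ρ ν g c σB z τ' lam ∧
                IsComputableDiffRing (laurentRootRep (F := F) (tailGen F x) z) σB ∧
                ComputableVia (laurentRep (F := F) x)
                  (laurentRootRep (F := F) (tailGen F x) z) lam)) := by
  refine ⟨fun u s hu H _ _ σH x α τ d h => ?_, fun ev L hF hev hL hev_comp hL_comp hτ => ?_⟩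
  · obtain ⟨σE, hE⟩ := h.exists_tailStatement
    obtain ⟨ρ, ν, g, c, hR⟩ := h.exists_isReduction hσ hu
    exact ⟨σE, hE, fun hd => ⟨g, c, h.exists_piFactorization (hd ▸ hR) hE⟩,
      fun hd => ⟨h.one_lt_lastEntry hd, ρ, ν, g, c,
        h.exists_rFactorization hR rfl (h.one_lt_lastEntry hd) hE⟩⟩
  · obtain ⟨search, partrec, spec⟩ := exists_partrec_outputCheck hF hev_comp hL_comp
    refine ⟨search, partrec, fun u s hu H _ _ σH x α τ d κ l h hx => ?_⟩
    obtain ⟨out, mem, N, hout⟩ := spec (_, _) (h.exists_outputCheck hτ hσ hu hx)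
    obtain ⟨ρ, ν, g, c, out_eq, hR⟩ := h.isReduction_of_outputCheck hτ hL hev hu hx hout
    obtain ⟨σE, hE⟩ := h.exists_tailStatement
    exact ⟨ρ, ν, g, c, σE, out_eq ▸ mem, hE,
      hE.isPiExtension.toIsPExtension.isComputableDiffRing hF,
      fun hd => h.exists_computable_piFactorization (hd ▸ hR) hE hF,
      fun hd => ⟨h.one_lt_lastEntry hd,
        h.exists_computable_rFactorization hR rfl (h.one_lt_lastEntry hd) hE hF⟩⟩

theorem mainTheorem3 {F : Type w} [Field F] [CharZero F] (σ : F ≃+* F)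
    (hσ : RadicalStable σ) (τF : F →+* SeqRing (constField σ))
    (hτF : IsKEmbedding σ (constIncl σ F) τF) :
    -- the structural part
    (∀ (u s : ℕ) (hu : 0 < u) (H : Type v) [CommRing H] [Algebra F H] (σH : H ≃+* H)
      (x : Fin (u + s) → Hˣ) (α : Fin (u + s) → Fˣ) (τ : H →+* SeqRing (constField σ))
      (d : Fin u → ℕ), SpecialCase σ τF σH x α τ d →
      ∃ σE : tailRing F x ≃+* tailRing F x, TailStatement σ σH x α τ σE ∧
        (lastEntry hu d = 1 →
          ∃ (g : Fin u → Fˣ) (c : Fin u → constField σ) (lam : H →+* tailRing F x),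
            PiFactorization σ σH x α τ d σE g c lam) ∧
        (lastEntry hu d ≠ 1 → 1 < lastEntry hu d ∧
          ∃ (ρ : constField σ) (ν : Fin u → ℕ) (g : Fin u → Fˣ) (c : Fin u → constField σ)
            (B : Type v) (_ : CommRing B) (_ : Algebra (tailRing F x) B) (σB : B ≃+* B) (z : B)
            (τ' : B →+* SeqRing (constField σ)) (lam : H →+* B),
            RFactorization σ σH x α τ d (lastEntry hu d) σE ρ ν g c σB z τ' lam)) ∧
    -- the algorithmic part
    (∀ [Primcodable F] (ev : F → ℕ → constField σ) (L Z : F → ℕ),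
      IsComputableDiffField σ → IsOSigmaComputable σ τF ev L Z → CanSolveHomogeneous σ →
      -- one algorithm handles all extensions; the input is the list of the triples `(αᵢ, κᵢ, lᵢ)`,
      -- where `τ xᵢ` is the sequence `κᵢ ∏_{lᵢ ≤ k < n} ev(αᵢ, k)`, and the list of the `dᵢ`;
      -- the output is `ρ` and the list of the triples `(ḡᵢ, νᵢ, cᵢ)`
      ∃ algo : List (F × F × ℕ) × List ℕ →. F × List (F × ℕ × F), Partrec algo ∧
        ∀ (u s : ℕ) (hu : 0 < u) (H : Type v) [CommRing H] [Algebra F H] (σH : H ≃+* H)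
          (x : Fin (u + s) → Hˣ) (α : Fin (u + s) → Fˣ) (τ : H →+* SeqRing (constField σ))
          (d : Fin u → ℕ) (κ : Fin (u + s) → constField σ) (l : Fin (u + s) → ℕ),
          SpecialCase σ τF σH x α τ d →
          (∀ i, τ (x i) = toSeq fun n => κ i * ∏ k ∈ Finset.Ico (l i) n, ev (α i) k) →
          ∃ (ρ : constField σ) (ν : Fin u → ℕ) (g : Fin u → Fˣ) (c : Fin u → constField σ)
            (σE : tailRing F x ≃+* tailRing F x),
            ((ρ : F), List.ofFn fun i => ((g i : F), ν i, (c i : F))) ∈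
              algo (List.ofFn fun i => ((α i : F), (κ i : F), l i), List.ofFn d) ∧
            TailStatement σ σH x α τ σE ∧
            IsComputableDiffRing (laurentRep (F := F) (tailGen F x)) σE ∧
            (lastEntry hu d = 1 → ∃ lam : H →+* tailRing F x,
              PiFactorization σ σH x α τ d σE g c lam ∧
              ComputableVia (laurentRep (F := F) x) (laurentRep (F := F) (tailGen F x)) lam) ∧
            (lastEntry hu d ≠ 1 → 1 < lastEntry hu d ∧
              ∃ (B : Type v) (_ : CommRing B) (_ : Algebra (tailRing F x) B) (σB : B ≃+* B)
                (z : B) (τ' : B →+* SeqRing (constField σ)) (lam : H →+* B),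
                RFactorization σ σH x α τ d (lastEntry hu d) σE ρ ν g c σB z τ' lam ∧
                IsComputableDiffRing (laurentRootRep (F := F) (tailGen F x) z) σB ∧
                ComputableVia (laurentRep (F := F) x)
                  (laurentRootRep (F := F) (tailGen F x) z) lam)) :=
  have ⟨structural, algorithmic⟩ := mainTheorem3_general σ hσ τF
  ⟨structural, fun ev L _ hF hO _ => algorithmic ev L hF hO.isEvaluation hO.isOSigmaFunction
    hO.computable_ev hO.computable_L hO.tau_eq⟩
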